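/- Theorem. (a) There is an absolute constant $C\ge 1$ such that the following holds. Let $G=(V,E)$ be a finite simple bipartite graph and let $x\in[0,1]^E$ be a fractional perfect matching, i.e. $\sum_{e\ni v}x_e=1$ for every vertex $v\in V$. Then for every $0<\delta\le 1$ there is a random matching $\mathcal M$ of $G$ such that 1. every vertex is matched by $\mathcal M$ with probability at least $1-\delta$; 2. every edge $e$ belongs to $\mathcal M$ with probability exactly $(1-\delta)x_e$; 3. the indicator vector $X=(\mathbf 1[e\in\mathcal M])_{e\in E}$ is $(C/\delta)$-concentrated around its mean, where a $0$-$1$ random vector $X$ with means $\bar x_e=\mathbb E[X_e]$ is called $\beta$-concentrated if for all $a\in\mathbb R^E$ and $t>0$, with $M=\max_e|a_e|$, $$\Pr\big[a\cdot X-\mathbb E[a\cdot X]\ge t\big]\le\exp\left(-\frac{t^2/\beta}{2\left(\sum_e a_e^2(\bar x_e-\bar x_e^2)+Mt/3\right)}\right).$$ (b) Let $t\ge 2$ be an integer and let $G=(V,E)$ be a finite connected simple graph that is not a cycle and contains no path on $t$ vertices all of which have degree exactly $2$ in $G$. Then $|E|\ge\left(1+\frac1{4t}\right)(d_2+d_{\ge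 3})$, where $d_2$ and $d_{\ge3}$ denote the numbers of vertices of $G$ of degree $2$ and of degree at least $3$. -/

import Mathlib

open MeasureTheory

/-- A fractional perfect matching of `G`: weights `x e ∈ [0,1]` on the edges such that the weights
of the edges incident to any vertex sum to `1`. -/
structure IsFractionalPerfectMatching {V : Type*} [DecidableEq V] (G : SimpleGraph V)
    [Fintype G.edgeSet] (x : G.edgeSet → ℝ) : Prop where
  mem_Icc : ∀ e, x e ∈ Set.Icc (0 : ℝ) 1
  sum_eq_one : ∀ v : V, ∑ e : G.edgeSet, (if v ∈ (e : Sym2 V) then x e else 0) = 1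

/-- `β`-concentration of a random vector `X = (X_i)` of `0`-`1` random variables (possibly
dependent) around its mean: every linear form `a · X` satisfies Bernstein's inequality up to a
factor `β` in the exponent, where `x_i = 𝔼[X_i]` and `M = max_i |a_i|`. -/
def IsBetaConcentrated {Ω ι : Type*} [MeasurableSpace Ω] [Fintype ι] (μ : Measure Ω)
    (X : Ω → ι → ℝ) (β : ℝ) : Prop :=
  ∀ (a : ι → ℝ) (t : ℝ), 0 < t →
    μ.real {ω | t ≤ ∑ i, a i * X ω i - ∫ ω', ∑ i, a i * X ω' i ∂μ} ≤
      Real.exp (-(t ^ 2 / β) /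
        (2 * (∑ i, a i ^ 2 * ((∫ ω, X ω i ∂μ) - (∫ ω, X ω i ∂μ) ^ 2) + (⨆ i, |a i|) * t / 3)))

/-- The indicator vector, indexed by the edges of `G`, of the edge set of a subgraph `M`. -/
noncomputable def edgeIndicator {V : Type*} {G : SimpleGraph V} (M : G.Subgraph) :
    G.edgeSet → ℝ :=
  fun e => M.edgeSet.indicator 1 (e : Sym2 V)

/-- `G` is a cycle: some cycle in `G` runs through all vertices and all edges of `G`. -/
def IsCycleGraph {V : Type*} (G : SimpleGraph V) : Prop :=
  ∃ (v : V) (p : G.Walk v v), p.IsCycle ∧ p.toSubgraph = ⊤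

/-! Rounding: the weights `(1 - δ) x` move by mean-zero steps through fractional matchings until
they are integral. Concentration survives if every increment `Δ` is sub-isotropic: `E⟨a, Δ⟩² ≤ K ∑
aᵢ² E Δᵢ²` for all `a`. For small `a` and `A = 7K`, `exp ∑ (aᵢ yᵢ + A aᵢ² (yᵢ - yᵢ²))` is then a
supermartingale (`expPotential_step`), because the loss of `yᵢ - yᵢ²` pays for the variance of the
linear part. A Chernoff argument ends with Bernstein's inequality. Every subspace of dimension at
least `n / K` contains such increments (`exists_subisotropic_family`).

The subspace preserves the sum at each vertex with at least two active, i.e. fractional, edges. With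
`m` active edges and `D` such vertices its dimension is at least `m - D`, which is at least `m / K`
when `m ≥ (1 + 1/(K - 1)) D`. This is the graph bound, in a form for disconnected graphs; it can
fail only for long chains of degree-two vertices or for small cycles. On a cycle, bipartiteness
makes one constraint redundant and leaves a direction to move in. In a long chain, one of `t`
consecutive edges is deleted at random and the others grow by `t/(t-1)`; a factor `(t-1)/t` held
back from the start pays for this. Each edge is exposed only once, since afterwards it stays near a
leaf. With `t` of order `1/δ`, the held-back factor costs at most `δ`, and `K = O(t) = O(1/δ)`.

Graph bound: let `X` be the sum of the degrees different from `2`. A dart leaving a degree-two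
vertex, followed without backtracking, soon meets a vertex of another degree, and the end dart with
the number of steps determines the start. Hence `2 d₂ ≤ (t - 1) X`, to be combined with `2|E| = 2 d₂
+ X` and `3 d₃ ≤ X`. -/

/-! ### Sub-isotropic families in large subspaces, by convex duality -/

/-- By Carathéodory, `finrank + 1` points suffice for each convex combination, so the hull is a
finite union of continuous images of compact sets. -/
theorem isCompact_convexHull_of_finiteDimensional {E : Type*} [NormedAddCommGroup E]
    [NormedSpace ℝ E] [FiniteDimensional ℝ E] {s : Set E} (hs : IsCompact s) :
    IsCompact (convexHull ℝ s) := by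
  have key : convexHull ℝ s = ⋃ m ∈ Finset.range (Module.finrank ℝ E + 2),
      (fun p : (Fin m → ℝ) × (Fin m → E) => ∑ k, p.1 k • p.2 k) ''
        (stdSimplex ℝ (Fin m) ×ˢ Set.univ.pi fun _ => s) := by
    ext x
    simp only [Set.mem_iUnion, Finset.mem_range]
    constructor
    · intro hx
      obtain ⟨κ, _, z, w, hz, hind, hw, hw1, hx⟩ := eq_pos_convex_span_of_mem_convexHull hx
      have hcard := hind.card_le_finrank_succ
      have := Submodule.finrank_le (vectorSpan ℝ (Set.range z))
      let e := Fintype.equivFin κ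
      refine ⟨Fintype.card κ, by omega, (w ∘ e.symm, z ∘ e.symm), ⟨⟨fun k => (hw _).le, ?_⟩,
        fun k _ => hz ⟨_, rfl⟩⟩, ?_⟩
      · rw [← hw1]; exact e.symm.sum_comp w
      · rw [← hx]; exact e.symm.sum_comp fun i => w i • z i
    · rintro ⟨m, -, ⟨w, z⟩, ⟨hw, hz⟩, rfl⟩
      exact (convex_convexHull ℝ s).sum_mem (fun k _ => hw.1 k) hw.2
        fun k _ => subset_convexHull ℝ s (hz k trivial)
  rw [key]
  refine (Finset.range _).isCompact_biUnion fun m _ => ?_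
  refine ((isCompact_stdSimplex ℝ (Fin m)).prod (isCompact_univ_pi fun _ => hs)).image ?_
  fun_prop

/-- A trace argument. Rescaling the coordinates by `√(Q i i)` turns `Q` into a matrix with unit
diagonal, of trace `card ι`, whose Rayleigh quotient exceeds `K` on the image of `W`. An orthonormal
basis of that image captures at most the whole trace, by Bessel applied to the rescaled rows of a
factor `B` of `Q`. -/
theorem Matrix.PosSemidef.mul_finrank_le_card {ι : Type*} [Fintype ι] [DecidableEq ι]
    {Q : Matrix ι ι ℝ} (hQ : Q.PosSemidef) (hd : ∀ i, 0 < Q i i) (W : Submodule ℝ (ι → ℝ))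
    (hW : 0 < Module.finrank ℝ W) {K : ℝ}
    (hlt : ∀ w ∈ W, w ≠ 0 → K * ∑ i, Q i i * w i ^ 2 < ∑ i, ∑ j, Q i j * (w i * w j)) :
    K * Module.finrank ℝ W < Fintype.card ι := by
  obtain ⟨B, hB⟩ : ∃ B : Matrix ι ι ℝ, Q = B.conjTranspose * B := by
    open scoped MatrixOrder in
    obtain ⟨B, hB⟩ := CStarAlgebra.nonneg_iff_eq_star_mul_self.mp hQ.nonneg
    exact ⟨B, hB⟩
  have hQB : ∀ i j, Q i j = ∑ r, B r i * B r j := by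
    intro i j; rw [hB]; simp [Matrix.mul_apply]
  have hs : ∀ i, Real.sqrt (Q i i) ≠ 0 := fun i => (Real.sqrt_pos.mpr (hd i)).ne'
  let T : (ι → ℝ) →ₗ[ℝ] EuclideanSpace ℝ ι :=
    { toFun := fun w => WithLp.toLp 2 fun i => Real.sqrt (Q i i) * w i
      map_add' := by intro x y; ext i; simp [mul_add]
      map_smul' := by intro c x; ext i; simp; ring }
  have hT : Function.Injective T := by
    intro x y h
    ext i
    have := congrArg (fun z : EuclideanSpace ℝ ι => z i) h
    simpa [T, hs i] using this
  have hfin : Module.finrank ℝ (W.map T) = Module.finrank ℝ W :=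
    (LinearEquiv.finrank_eq (Submodule.equivMapOfInjective T hT W)).symm
  let b := stdOrthonormalBasis ℝ (W.map T)
  have hb : Orthonormal ℝ fun k => ((b k : W.map T) : EuclideanSpace ℝ ι) :=
    b.orthonormal.comp_linearIsometry (W.map T).subtypeₗᵢ
  choose w hwW hwT using fun k => Submodule.mem_map.mp (b k).2
  have hw0 : ∀ k, w k ≠ 0 := by
    intro k h
    have := hb.ne_zero k
    rw [← hwT k, h, map_zero] at this
    exact this rfl
  have hnorm : ∀ k, ∑ i, Q i i * w k i ^ 2 = 1 := by
    intro k
    have h1 : ‖((b k : W.map T) : EuclideanSpace ℝ ι)‖ = 1 := hb.1 k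
    rw [← hwT k, EuclideanSpace.norm_eq, Real.sqrt_eq_one] at h1
    rw [← h1]
    refine Finset.sum_congr rfl fun i _ => ?_
    simp [T, mul_pow, Real.sq_sqrt (hd i).le]
  let c : ι → EuclideanSpace ℝ ι := fun r => WithLp.toLp 2 fun i => B r i / Real.sqrt (Q i i)
  have hin : ∀ k r, inner ℝ ((b k : W.map T) : EuclideanSpace ℝ ι) (c r) = ∑ i, B r i * w k i := by
    intro k r
    rw [← hwT k, PiLp.inner_apply]
    refine Finset.sum_congr rfl fun i _ => ?_
    simp only [T, c, LinearMap.coe_mk, AddHom.coe_mk, RCLike.inner_apply, conj_trivial]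
    field_simp [hs i]
  have hquad : ∀ k, ∑ i, ∑ j, Q i j * (w k i * w k j) = ∑ r, (∑ i, B r i * w k i) ^ 2 := by
    intro k
    simp_rw [hQB, sq, Finset.sum_mul_sum, Finset.sum_mul]
    rw [Finset.sum_congr rfl fun i _ => Finset.sum_comm, Finset.sum_comm]
    refine Finset.sum_congr rfl fun r _ => Finset.sum_congr rfl fun i _ =>
      Finset.sum_congr rfl fun j _ => by ring
  have hbessel : ∀ r, ∑ k, (∑ i, B r i * w k i) ^ 2 ≤ ∑ i, B r i ^ 2 / Q i i := by
    intro r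
    have := hb.sum_inner_products_le (c r) (s := Finset.univ)
    simp_rw [hin, Real.norm_eq_abs, sq_abs] at this
    refine this.trans_eq ?_
    rw [EuclideanSpace.norm_sq_eq]
    refine Finset.sum_congr rfl fun i _ => ?_
    simp [c, div_pow, Real.sq_sqrt (hd i).le]
  have hlow : K * Module.finrank ℝ W < ∑ k, ∑ i, ∑ j, Q i j * (w k i * w k j) := by
    have : ∑ _k : Fin (Module.finrank ℝ (W.map T)), K <
        ∑ k, ∑ i, ∑ j, Q i j * (w k i * w k j) := by
      refine Finset.sum_lt_sum_of_nonempty ?_ fun k _ => ?_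
      · rw [← Finset.card_pos]; simpa [hfin] using hW
      · have := hlt (w k) (hwW k) (hw0 k)
        rwa [hnorm, mul_one] at this
    simpa [hfin, mul_comm] using this
  refine hlow.trans_le ?_
  simp_rw [hquad]
  rw [Finset.sum_comm]
  refine (Finset.sum_le_sum fun r _ => hbessel r).trans ?_
  rw [Finset.sum_comm]
  have : ∀ i, ∑ r, B r i ^ 2 / Q i i = 1 := by
    intro i
    rw [← Finset.sum_div, div_eq_one_iff_eq (hd i).ne', hQB]
    exact Finset.sum_congr rfl fun r _ => sq _
  simp [this]

/-- The inequality says that `∑ v vᵀ` is at most `K` times its diagonal. If no convex combination of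
the matrices `K diag(w wᵀ) - w wᵀ`, with `w` on the unit sphere of `W`, had a nonnegative quadratic
form, then a functional separating them from the cone of such matrices would yield a `Q` violating
the trace bound. -/
theorem exists_subisotropic_family {ι : Type*} [Fintype ι] [Nonempty ι]
    (W : Submodule ℝ (ι → ℝ)) (K : ℝ) (hK : (Fintype.card ι : ℝ) ≤ K * Module.finrank ℝ W) :
    ∃ (m : ℕ) (v : Fin m → ι → ℝ), (∀ k, v k ∈ W) ∧ (∃ k i, v k i ≠ 0) ∧
      ∀ a : ι → ℝ, ∑ k, (∑ i, a i * v k i) ^ 2 ≤ K * ∑ i, a i ^ 2 * ∑ k, v k i ^ 2 := by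
  classical
  have hn : (0 : ℝ) < Fintype.card ι := by exact_mod_cast Fintype.card_pos
  have hW : 0 < Module.finrank ℝ W := by
    rcases Nat.eq_zero_or_pos (Module.finrank ℝ W) with h | h
    · rw [h] at hK; simp at hK
    · exact h
  let φ : (ι → ℝ) → ι → ι → ℝ := fun w i j => (if i = j then K * w i ^ 2 else 0) - w i * w j
  let S : Set (ι → ℝ) := (W : Set (ι → ℝ)) ∩ Metric.sphere 0 1
  let P : Set (ι → ι → ℝ) := {B | ∀ a : ι → ℝ, 0 ≤ ∑ i, ∑ j, B i j * (a i * a j)}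
  have hφ : Continuous φ := by
    refine continuous_pi fun i => continuous_pi fun j => ?_
    by_cases h : i = j
    · simp only [φ, h, if_true]; fun_prop
    · simp only [φ, h, if_false]; fun_prop
  have hS : IsCompact S := (isCompact_sphere 0 1).inter_left W.closed_of_finiteDimensional
  have hPconv : Convex ℝ P := by
    intro A hA B hB s t hs ht _ a
    have h : ∑ i, ∑ j, (s • A + t • B) i j * (a i * a j) =
        s * ∑ i, ∑ j, A i j * (a i * a j) + t * ∑ i, ∑ j, B i j * (a i * a j) := by
      simp_rw [Finset.mul_sum, ← Finset.sum_add_distrib]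
      refine Finset.sum_congr rfl fun i _ => Finset.sum_congr rfl fun j _ => ?_
      simp; ring
    rw [h]
    exact add_nonneg (mul_nonneg hs (hA a)) (mul_nonneg ht (hB a))
  have hPclosed : IsClosed P := by
    have : P = ⋂ a : ι → ℝ, {B | 0 ≤ ∑ i, ∑ j, B i j * (a i * a j)} := by ext; simp [P]
    rw [this]
    refine isClosed_iInter fun a => isClosed_le continuous_const ?_
    fun_prop
  have hmeet : ¬ Disjoint (convexHull ℝ (φ '' S)) P := by
    intro hdis
    obtain ⟨f, u, v, hfu, huv, hfv⟩ := geometric_hahn_banach_compact_closed (convex_convexHull ℝ _)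
      (isCompact_convexHull_of_finiteDimensional (hS.image hφ)) hPconv hPclosed hdis
    have hu : u < 0 := by
      have := hfv 0 (by intro a; simp)
      rw [map_zero] at this; linarith
    -- `P` is a cone, so a matrix with a negative value could be scaled to have value exactly `v`.
    have hfP : ∀ B ∈ P, 0 ≤ f B := by
      intro B hB
      by_contra! hneg
      have h1 : 0 ≤ v / f B := div_nonneg_of_nonpos
        (by have := hfv 0 (by intro a; simp); rw [map_zero] at this; linarith) hneg.le
      have := hfv ((v / f B) • B) (by
        intro a
        have h := mul_nonneg h1 (hB a)
        simp_rw [Finset.mul_sum] at h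
        refine h.trans_eq (Finset.sum_congr rfl fun i _ => Finset.sum_congr rfl fun j _ => ?_)
        exact (mul_assoc _ _ _).symm)
      rw [map_smul, smul_eq_mul, div_mul_cancel₀ _ hneg.ne] at this
      exact lt_irrefl _ this
    let E : ι → ι → ι → ι → ℝ := fun i j => Pi.single i (Pi.single j 1)
    have hf : ∀ B : ι → ι → ℝ, f B = ∑ i, ∑ j, B i j * f (E i j) := by
      intro B
      have : B = ∑ i, ∑ j, B i j • E i j := by
        ext k l
        simp only [E, Finset.sum_apply, Pi.smul_apply, smul_eq_mul]
        rw [Finset.sum_eq_single k, Finset.sum_eq_single l] <;> simp +contextual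
      conv_lhs => rw [this]
      simp only [map_sum, map_smul, smul_eq_mul]
    -- Adding `ε` times the identity makes the diagonal of `Q` positive. The margin `-u` absorbs it,
    -- because `∑ w i ^ 2 ≤ card ι` for unit vectors of the sup norm.
    let ε : ℝ := -u / ((|K| + 1) * Fintype.card ι)
    have hε : 0 < ε := div_pos (by linarith) (by positivity)
    let Q : Matrix ι ι ℝ := fun i j =>
      (f (E i j) + f (E j i)) / 2 + if i = j then ε else 0
    have hQf : ∀ a : ι → ℝ, ∑ i, ∑ j, Q i j * (a i * a j) =
        f (fun i j => a i * a j) + ε * ∑ i, a i ^ 2 := by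
      intro a
      rw [hf]
      have hsym : ∑ i, ∑ j, a i * a j * f (E i j) = ∑ i, ∑ j, a i * a j * f (E j i) := by
        rw [Finset.sum_comm]
        exact Finset.sum_congr rfl fun i _ => Finset.sum_congr rfl fun j _ => by ring
      have hdiag : ε * ∑ i, a i ^ 2 = ∑ i, ∑ j, (if i = j then ε else 0) * (a i * a j) := by
        simp [Finset.mul_sum, sq]
      have hhalf : ∑ i, ∑ j, a i * a j * f (E i j) =
          ∑ i, ∑ j, (f (E i j) + f (E j i)) / 2 * (a i * a j) := by
        have : ∑ i, ∑ j, (f (E i j) + f (E j i)) / 2 * (a i * a j) =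
            (∑ i, ∑ j, a i * a j * f (E i j) + ∑ i, ∑ j, a i * a j * f (E j i)) / 2 := by
          simp_rw [← Finset.sum_add_distrib, Finset.sum_div]
          exact Finset.sum_congr rfl fun i _ => Finset.sum_congr rfl fun j _ => by ring
        rw [this, ← hsym]; ring
      rw [hhalf, hdiag]
      simp_rw [← Finset.sum_add_distrib]
      exact Finset.sum_congr rfl fun i _ => Finset.sum_congr rfl fun j _ => by
        simp only [Q]; ring
    have hrank1 : ∀ a : ι → ℝ, (fun i j => a i * a j) ∈ P := by
      intro a b
      have : ∑ i, ∑ j, a i * a j * (b i * b j) = (∑ i, a i * b i) ^ 2 := by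
        rw [sq, Finset.sum_mul_sum]
        exact Finset.sum_congr rfl fun i _ => Finset.sum_congr rfl fun j _ => by ring
      rw [this]; positivity
    have hQpsd : Q.PosSemidef := by
      refine Matrix.PosSemidef.of_dotProduct_mulVec_nonneg ?_ fun a => ?_
      · ext i j
        change star (Q j i) = Q i j
        simp only [Q, star_trivial, eq_comm (a := j), add_comm (f (E j i))]
      · have h : star a ⬝ᵥ Q.mulVec a = ∑ i, ∑ j, Q i j * (a i * a j) := by
          simp only [dotProduct, Matrix.mulVec, Finset.mul_sum, Pi.star_apply, star_trivial]
          exact Finset.sum_congr rfl fun i _ => Finset.sum_congr rfl fun j _ => by ring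
        rw [h, hQf]
        have := hfP _ (hrank1 a)
        positivity
    have hQd : ∀ i, 0 < Q i i := by
      intro i
      have h := hfP _ (hrank1 (Pi.single i 1))
      have h2 : (fun k l => (Pi.single i 1 : ι → ℝ) k * (Pi.single i 1 : ι → ℝ) l) = E i i := by
        ext k l
        by_cases hk : k = i
        · subst hk; simp [E]
        · simp [E, hk]
      rw [h2] at h
      simp only [Q, if_true]
      linarith
    have hunit : ∀ w ∈ S, K * ∑ i, Q i i * w i ^ 2 < ∑ i, ∑ j, Q i j * (w i * w j) := by
      intro w hw
      have h1 := hfu _ (subset_convexHull ℝ _ ⟨w, hw, rfl⟩)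
      have h2 : f (φ w) = K * ∑ i, f (E i i) * w i ^ 2 - f (fun i j => w i * w j) := by
        rw [hf, hf (fun i j => w i * w j)]
        simp only [φ, sub_mul, Finset.sum_sub_distrib, ite_mul, zero_mul, Finset.sum_ite_eq,
          Finset.mem_univ, if_true, Finset.mul_sum]
        congr 1
        exact Finset.sum_congr rfl fun i _ => by ring
      have h3 : ∑ i, Q i i * w i ^ 2 = ∑ i, f (E i i) * w i ^ 2 + ε * ∑ i, w i ^ 2 := by
        rw [Finset.mul_sum, ← Finset.sum_add_distrib]
        exact Finset.sum_congr rfl fun i _ => by simp [Q]; ring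
      have h4 : ∑ i, w i ^ 2 ≤ Fintype.card ι := by
        have : ∀ i, w i ^ 2 ≤ 1 := by
          intro i
          have h := norm_le_pi_norm w i
          rw [mem_sphere_zero_iff_norm.mp hw.2, Real.norm_eq_abs] at h
          exact (sq_le_one_iff_abs_le_one _).mpr h
        simpa using Finset.sum_le_sum fun i (_ : i ∈ Finset.univ) => this i
      have h5 : ε * ((|K| + 1) * Fintype.card ι) = -u := by
        simp only [ε]; field_simp
      have h6 : (0 : ℝ) ≤ ∑ i, w i ^ 2 := by positivity
      have h7 : (K - 1) * (ε * ∑ i, w i ^ 2) ≤ (|K| + 1) * (ε * Fintype.card ι) := by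
        refine mul_le_mul ?_ (mul_le_mul_of_nonneg_left h4 hε.le) (by positivity) (by positivity)
        linarith [le_abs_self K]
      rw [hQf, h3]
      rw [h2] at h1
      nlinarith
    refine (hK.trans_lt' ((hQpsd.mul_finrank_le_card hQd W hW fun w hw hw0 => ?_))).false
    have hnw : 0 < ‖w‖ := norm_pos_iff.mpr hw0
    have h := hunit (‖w‖⁻¹ • w) ⟨W.smul_mem _ hw, by
      simp [norm_smul, hnw.ne']⟩
    have e1 : K * ∑ i, Q i i * (‖w‖⁻¹ • w) i ^ 2 = ‖w‖⁻¹ ^ 2 * (K * ∑ i, Q i i * w i ^ 2) := by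
      simp_rw [Finset.mul_sum]
      exact Finset.sum_congr rfl fun i _ => by simp only [Pi.smul_apply, smul_eq_mul]; ring
    have e2 : ∑ i, ∑ j, Q i j * ((‖w‖⁻¹ • w) i * (‖w‖⁻¹ • w) j) =
        ‖w‖⁻¹ ^ 2 * ∑ i, ∑ j, Q i j * (w i * w j) := by
      simp_rw [Finset.mul_sum]
      exact Finset.sum_congr rfl fun i _ => Finset.sum_congr rfl fun j _ => by
        simp only [Pi.smul_apply, smul_eq_mul]; ring
    rw [e1, e2] at h
    exact lt_of_mul_lt_mul_left h (by positivity)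
  obtain ⟨B, hB, hBP⟩ := Set.not_disjoint_iff.mp hmeet
  obtain ⟨κ, _, z, c, hz, -, hc, hc1, hx⟩ := eq_pos_convex_span_of_mem_convexHull hB
  choose w hw hwz using fun k => hz ⟨k, rfl⟩
  let e := Fintype.equivFin κ
  -- The convex weights enter the quadratic expressions through the square roots.
  refine ⟨Fintype.card κ, fun k => Real.sqrt (c (e.symm k)) • w (e.symm k),
    fun k => W.smul_mem _ (hw _).1, ?_, fun a => ?_⟩
  · have : Nonempty κ := by
      by_contra h
      rw [not_nonempty_iff] at h
      simp at hc1
    obtain ⟨k⟩ := this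
    have h0 : w k ≠ 0 := by
      intro h
      have := mem_sphere_zero_iff_norm.mp (hw k).2
      simp [h] at this
    obtain ⟨i, hi⟩ := Function.ne_iff.mp h0
    exact ⟨e k, i, by simpa [(Real.sqrt_pos.mpr (hc k)).ne'] using hi⟩
  · have h := hBP a
    rw [← hx] at h
    have e1 : ∑ i, ∑ j, (∑ k, c k • z k) i j * (a i * a j) =
        K * ∑ i, a i ^ 2 * ∑ k, c k * w k i ^ 2 - ∑ k, c k * (∑ i, a i * w k i) ^ 2 := by
      have h1 : ∀ k, (∑ i, a i * w k i) ^ 2 = ∑ i, ∑ j, w k i * w k j * (a i * a j) := by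
        intro k
        rw [sq, Finset.sum_mul_sum]
        exact Finset.sum_congr rfl fun i _ => Finset.sum_congr rfl fun j _ => by ring
      have h2 : ∑ i, ∑ j, (∑ k, c k • z k) i j * (a i * a j) =
          ∑ k, c k * ∑ i, ∑ j, z k i j * (a i * a j) := by
        simp only [Finset.sum_apply, Pi.smul_apply, smul_eq_mul, Finset.sum_mul, Finset.mul_sum]
        rw [Finset.sum_congr rfl fun i _ => Finset.sum_comm, Finset.sum_comm]
        exact Finset.sum_congr rfl fun k _ => Finset.sum_congr rfl fun i _ =>
          Finset.sum_congr rfl fun j _ => by ring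
      have h3 : ∀ k, ∑ i, ∑ j, z k i j * (a i * a j) =
          K * ∑ i, a i ^ 2 * w k i ^ 2 - (∑ i, a i * w k i) ^ 2 := by
        intro k
        rw [h1, ← hwz]
        simp only [φ, sub_mul, Finset.sum_sub_distrib, ite_mul, zero_mul, Finset.sum_ite_eq,
          Finset.mem_univ, if_true, Finset.mul_sum]
        congr 1
        exact Finset.sum_congr rfl fun i _ => by ring
      rw [h2]
      simp_rw [h3, mul_sub, Finset.sum_sub_distrib, Finset.mul_sum]
      rw [Finset.sum_comm]
      congr 1
      exact Finset.sum_congr rfl fun i _ => Finset.sum_congr rfl fun k _ => by ring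
    rw [e1] at h
    have e2 : ∀ k, (∑ i, a i * (Real.sqrt (c (e.symm k)) • w (e.symm k)) i) ^ 2 =
        c (e.symm k) * (∑ i, a i * w (e.symm k) i) ^ 2 := by
      intro k
      have : ∑ i, a i * (Real.sqrt (c (e.symm k)) • w (e.symm k)) i =
          Real.sqrt (c (e.symm k)) * ∑ i, a i * w (e.symm k) i := by
        rw [Finset.mul_sum]
        exact Finset.sum_congr rfl fun i _ => by simp only [Pi.smul_apply, smul_eq_mul]; ring
      rw [this, mul_pow, Real.sq_sqrt (hc _).le]
    have e3 : ∀ i, ∑ k, (Real.sqrt (c (e.symm k)) • w (e.symm k)) i ^ 2 =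
        ∑ k, c k * w k i ^ 2 := by
      intro i
      rw [← e.symm.sum_comp fun k => c k * w k i ^ 2]
      exact Finset.sum_congr rfl fun k _ => by
        simp only [Pi.smul_apply, smul_eq_mul, mul_pow, Real.sq_sqrt (hc _).le]
    simp_rw [e2, e3]
    rw [e.symm.sum_comp fun k => c k * (∑ i, a i * w k i) ^ 2]
    linarith

/-! ### The exponential potential and a single random step -/

/-- The exponential potential whose supermartingale property yields Bernstein's inequality. -/
noncomputable def expPotential {ι : Type*} [Fintype ι] (A : ℝ) (a y : ι → ℝ) : ℝ :=
  Real.exp (∑ i, (a i * y i + A * a i ^ 2 * (y i - y i ^ 2)))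

/-- The functions on the cube that a rounding scheme must not increase in expectation. -/
def testFunctions (ι : Type*) [Fintype ι] (A : ℝ) : Set ((ι → ℝ) → ℝ) :=
  {f | (∃ a : ι → ℝ, (∀ i, 4 * A * |a i| ≤ 1) ∧ f = expPotential A a) ∨
    ∃ i, f = (fun y => y i) ∨ f = fun y => 1 - y i}

/-- Nonnegativity allows mass to be abandoned, since this only lowers expectations; hence `1 - y i`
and not `-y i` in the family. At total mass one the two kinds of coordinate functions together fix
the means. -/
theorem testFunctions_nonneg {ι : Type*} [Fintype ι] {A : ℝ} {f : (ι → ℝ) → ℝ}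
    (hf : f ∈ testFunctions ι A) {y : ι → ℝ} (hy : ∀ i, y i ∈ Set.Icc (0 : ℝ) 1) : 0 ≤ f y := by
  rcases hf with ⟨a, -, rfl⟩ | ⟨i, rfl | rfl⟩
  · exact (Real.exp_pos _).le
  · exact (hy i).1
  · exact sub_nonneg.mpr (hy i).2

/-- The exponent changes by exactly `u - w`: `u` is linear in `Δ` with coefficients `b`, and `w = ∑
A aᵢ² Δᵢ²` comes from the concave term. The mean of `u` is zero, and sub-isotropy bounds the mean of
`u²` by a multiple of the mean of `w`. -/
theorem expPotential_step {ι κ : Type*} [Fintype ι] [Fintype κ] {K : ℝ} (hK : 1 ≤ K)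
    {q : κ → ℝ} (hq : ∀ k, 0 ≤ q k) (hq1 : ∑ k, q k = 1) {y : ι → ℝ}
    (hy : ∀ i, y i ∈ Set.Icc (0 : ℝ) 1) {Δ : κ → ι → ℝ} (hmean : ∀ i, ∑ k, q k * Δ k i = 0)
    (hsub : ∀ a : ι → ℝ, ∑ k, q k * (∑ i, a i * Δ k i) ^ 2 ≤
      K * ∑ i, a i ^ 2 * ∑ k, q k * Δ k i ^ 2)
    (hl1 : ∀ k, ∑ i, |Δ k i| ≤ 4) (hsup : ∀ k i, |Δ k i| ≤ 1)
    {a : ι → ℝ} (ha : ∀ i, 4 * (7 * K) * |a i| ≤ 1) :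
    ∑ k, q k * expPotential (7 * K) a (y + Δ k) ≤ expPotential (7 * K) a y := by
  set A := 7 * K with hA
  have hAa : ∀ i, A * a i ^ 2 ≤ |a i| / 4 := by
    intro i
    rw [← sq_abs]
    nlinarith [ha i, abs_nonneg (a i)]
  have ha28 : ∀ i, |a i| ≤ 1 / 28 := by
    intro i
    nlinarith [ha i, abs_nonneg (a i)]
  let b : ι → ℝ := fun i => a i + A * a i ^ 2 * (1 - 2 * y i)
  have hb : ∀ i, |b i| ≤ 5 / 4 * |a i| := by
    intro i
    have h1 : |A * a i ^ 2 * (1 - 2 * y i)| ≤ |a i| / 4 := by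
      have h0 : 0 ≤ A * a i ^ 2 := by positivity
      rw [abs_mul, abs_of_nonneg h0]
      have : |1 - 2 * y i| ≤ 1 := abs_le.mpr ⟨by linarith [(hy i).2], by linarith [(hy i).1]⟩
      nlinarith [hAa i]
    calc |b i| ≤ |a i| + |A * a i ^ 2 * (1 - 2 * y i)| := abs_add_le _ _
      _ ≤ _ := by linarith
  let u : κ → ℝ := fun k => ∑ i, b i * Δ k i
  let w : κ → ℝ := fun k => ∑ i, A * a i ^ 2 * Δ k i ^ 2
  have hexp : ∀ k, expPotential A a (y + Δ k) = expPotential A a y * Real.exp (u k - w k) := by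
    intro k
    simp only [expPotential, ← Real.exp_add, u, w, ← Finset.sum_sub_distrib,
      ← Finset.sum_add_distrib]
    congr 1
    exact Finset.sum_congr rfl fun i _ => by simp only [b, Pi.add_apply]; ring
  have hu : ∀ k, |u k| ≤ 1 / 2 := by
    intro k
    calc |u k| ≤ ∑ i, |b i * Δ k i| := Finset.abs_sum_le_sum_abs _ _
      _ ≤ ∑ i, 5 / 112 * |Δ k i| := Finset.sum_le_sum fun i _ => by
          rw [abs_mul]
          exact mul_le_mul_of_nonneg_right (by linarith [hb i, ha28 i]) (abs_nonneg _)
      _ ≤ _ := by rw [← Finset.mul_sum]; linarith [hl1 k]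
  have hw0 : ∀ k, 0 ≤ w k := fun k => Finset.sum_nonneg fun i _ => by positivity
  have hw : ∀ k, w k ≤ 1 / 4 := by
    intro k
    calc w k ≤ ∑ i, 1 / 112 * |Δ k i| := Finset.sum_le_sum fun i _ => by
          have h1 := hAa i
          have h2 := ha28 i
          have h3 : Δ k i ^ 2 ≤ |Δ k i| := by
            rw [← sq_abs]; nlinarith [hsup k i, abs_nonneg (Δ k i)]
          exact mul_le_mul (by linarith) h3 (by positivity) (by norm_num)
      _ ≤ _ := by rw [← Finset.mul_sum]; linarith [hl1 k]
  -- From `|eˣ - 1 - x| ≤ x²` and `(u - w)² ≤ 2u² + 2w²`; as `w ≤ 1/4`, half of `w` absorbs `2w²`.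
  have hpt : ∀ k, Real.exp (u k - w k) ≤ 1 + u k - w k / 2 + 2 * u k ^ 2 := by
    intro k
    have h1 := abs_le.mp (hu k)
    have h2 := hw0 k
    have h3 := hw k
    have h := (abs_le.mp (Real.abs_exp_sub_one_sub_id_le (x := u k - w k)
      (abs_le.mpr ⟨by linarith, by linarith⟩))).2
    nlinarith [sq_nonneg (u k + w k)]
  have hEu : ∑ k, q k * u k = 0 := by
    simp only [u, Finset.mul_sum]
    rw [Finset.sum_comm]
    refine Finset.sum_eq_zero fun i _ => ?_
    rw [← mul_zero (b i), ← hmean i, Finset.mul_sum]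
    exact Finset.sum_congr rfl fun k _ => by ring
  let S : ℝ := ∑ i, a i ^ 2 * ∑ k, q k * Δ k i ^ 2
  have hV : ∀ i, 0 ≤ ∑ k, q k * Δ k i ^ 2 := fun i =>
    Finset.sum_nonneg fun k _ => mul_nonneg (hq k) (sq_nonneg _)
  have hEw : ∑ k, q k * w k = A * S := by
    simp only [w, S, Finset.mul_sum]
    rw [Finset.sum_comm]
    exact Finset.sum_congr rfl fun i _ => Finset.sum_congr rfl fun k _ => by ring
  have hEu2 : ∑ k, q k * u k ^ 2 ≤ K * (25 / 16 * S) := by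
    refine (hsub b).trans (mul_le_mul_of_nonneg_left ?_ (by linarith))
    rw [Finset.mul_sum]
    refine Finset.sum_le_sum fun i _ => ?_
    rw [← mul_assoc]
    refine mul_le_mul_of_nonneg_right ?_ (hV i)
    rw [← sq_abs, ← sq_abs (a i)]
    nlinarith [hb i, abs_nonneg (b i), abs_nonneg (a i)]
  have hS : 0 ≤ S := Finset.sum_nonneg fun i _ => mul_nonneg (sq_nonneg _) (hV i)
  have hmain : ∑ k, q k * Real.exp (u k - w k) ≤ 1 := by
    calc ∑ k, q k * Real.exp (u k - w k)
        ≤ ∑ k, q k * (1 + u k - w k / 2 + 2 * u k ^ 2) :=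
          Finset.sum_le_sum fun k _ => mul_le_mul_of_nonneg_left (hpt k) (hq k)
      _ = ∑ k, q k + ∑ k, q k * u k - (∑ k, q k * w k) / 2 + 2 * ∑ k, q k * u k ^ 2 := by
          rw [Finset.sum_div, Finset.mul_sum, ← Finset.sum_add_distrib, ← Finset.sum_sub_distrib,
            ← Finset.sum_add_distrib]
          exact Finset.sum_congr rfl fun k _ => by ring
      _ ≤ 1 := by
          rw [hq1, hEu, hEw]
          -- The factor `7` in `A = 7K` suffices because `2 · 25/16 ≤ 7/2`.
          nlinarith [mul_nonneg (by linarith : (0 : ℝ) ≤ K) hS]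
  calc ∑ k, q k * expPotential A a (y + Δ k)
      = expPotential A a y * ∑ k, q k * Real.exp (u k - w k) := by
        rw [Finset.mul_sum]
        exact Finset.sum_congr rfl fun k _ => by rw [hexp]; ring
    _ ≤ _ := mul_le_of_le_one_right (Real.exp_pos _).le hmain

theorem testFunctions_step {ι κ : Type*} [Fintype ι] [Fintype κ] {K : ℝ} (hK : 1 ≤ K)
    {q : κ → ℝ} (hq : ∀ k, 0 ≤ q k) (hq1 : ∑ k, q k = 1) {y : ι → ℝ}
    (hy : ∀ i, y i ∈ Set.Icc (0 : ℝ) 1) {Δ : κ → ι → ℝ} (hmean : ∀ i, ∑ k, q k * Δ k i = 0)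
    (hsub : ∀ a : ι → ℝ, ∑ k, q k * (∑ i, a i * Δ k i) ^ 2 ≤
      K * ∑ i, a i ^ 2 * ∑ k, q k * Δ k i ^ 2)
    (hl1 : ∀ k, ∑ i, |Δ k i| ≤ 4) (hsup : ∀ k i, |Δ k i| ≤ 1) :
    ∀ f ∈ testFunctions ι (7 * K), ∑ k, q k * f (y + Δ k) ≤ f y := by
  rintro f (⟨a, ha, rfl⟩ | ⟨i, rfl | rfl⟩)
  · exact expPotential_step hK hq hq1 hy hmean hsub hl1 hsup ha
  · simp only [Pi.add_apply, mul_add, Finset.sum_add_distrib, hmean, ← Finset.sum_mul, hq1]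
    simp
  · simp only [Pi.add_apply, mul_sub, mul_add, Finset.sum_sub_distrib, Finset.sum_add_distrib,
      hmean, ← Finset.sum_mul, hq1]
    simp

/-! ### Rounding by finite sub-distributions -/

/-- `y` can be rounded to the points `z ω`, up to an abandoned mass of at most `θ`, without
increasing the expectation of any test function. -/
def RoundsUpTo {ι Ω : Type*} [Fintype ι] [Fintype Ω] (A : ℝ) (z : Ω → ι → ℝ) (y : ι → ℝ)
    (θ : ℝ) : Prop :=
  ∃ p : Ω → ℝ, (∀ ω, 0 ≤ p ω) ∧ ∑ ω, p ω ≤ 1 ∧ 1 - θ ≤ ∑ ω, p ω ∧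
    ∀ f ∈ testFunctions ι A, ∑ ω, p ω * f (z ω) ≤ f y

namespace RoundsUpTo

variable {ι Ω : Type*} [Fintype ι] [Fintype Ω] {A : ℝ} {z : Ω → ι → ℝ} {y : ι → ℝ}

theorem mono {θ θ' : ℝ} (h : RoundsUpTo A z y θ) (hθ : θ ≤ θ') : RoundsUpTo A z y θ' := by
  obtain ⟨p, h0, h1, h2, h3⟩ := h
  exact ⟨p, h0, h1, by linarith, h3⟩

theorem one (hy : ∀ i, y i ∈ Set.Icc (0 : ℝ) 1) : RoundsUpTo A z y 1 :=
  ⟨0, fun _ => le_rfl, by simp, by simp, fun f hf => by simpa using testFunctions_nonneg hf hy⟩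

theorem of_eq (ω : Ω) (h : z ω = y) : RoundsUpTo A z y 0 := by
  classical
  refine ⟨Pi.single ω 1, fun ω' => ?_, by simp, by simp, fun f _ => ?_⟩
  · by_cases h' : ω' = ω
    · subst h'; simp
    · simp [h']
  · rw [Finset.sum_eq_single ω] <;> simp +contextual [h]

theorem mix {κ : Type*} [Fintype κ] {q : κ → ℝ} (hq : ∀ k, 0 ≤ q k) (hq1 : ∑ k, q k = 1)
    {s : κ → ι → ℝ} (hs : ∀ f ∈ testFunctions ι A, ∑ k, q k * f (s k) ≤ f y) {θ : κ → ℝ}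
    (h : ∀ k, RoundsUpTo A z (s k) (θ k)) : RoundsUpTo A z y (∑ k, q k * θ k) := by
  choose p h0 h1 h2 h3 using h
  have hsum : ∑ ω, ∑ k, q k * p k ω = ∑ k, q k * ∑ ω, p k ω := by
    rw [Finset.sum_comm]; simp_rw [Finset.mul_sum]
  refine ⟨fun ω => ∑ k, q k * p k ω,
    fun ω => Finset.sum_nonneg fun k _ => mul_nonneg (hq k) (h0 k ω), ?_, ?_, fun f hf => ?_⟩
  · rw [hsum, ← hq1]
    exact Finset.sum_le_sum fun k _ => mul_le_of_le_one_right (hq k) (h1 k)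
  · rw [hsum]
    conv_lhs => rw [← hq1]
    rw [← Finset.sum_sub_distrib]
    exact Finset.sum_le_sum fun k _ => by nlinarith [hq k, h2 k]
  · refine le_trans ?_ (hs f hf)
    simp_rw [Finset.sum_mul]
    rw [Finset.sum_comm]
    refine Finset.sum_le_sum fun k _ => ?_
    simp_rw [mul_assoc]
    rw [← Finset.mul_sum]
    exact mul_le_mul_of_nonneg_left (h3 k f hf) (hq k)

theorem mix_zero {κ : Type*} [Fintype κ] {q : κ → ℝ} (hq : ∀ k, 0 ≤ q k) (hq1 : ∑ k, q k = 1)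
    {s : κ → ι → ℝ} (hs : ∀ f ∈ testFunctions ι A, ∑ k, q k * f (s k) ≤ f y)
    (h : ∀ k, RoundsUpTo A z (s k) 0) : RoundsUpTo A z y 0 := by
  simpa using mix hq hq1 hs h

/-- The admissible weights form a compact set, so a maximal total mass is attained, and it is at
least `1 - θ` for every `θ`. -/
theorem closure (h : ∀ θ > 0, RoundsUpTo A z y θ) : RoundsUpTo A z y 0 := by
  let C : Set (Ω → ℝ) := {p | (∀ ω, 0 ≤ p ω) ∧ ∑ ω, p ω ≤ 1 ∧
    ∀ f ∈ testFunctions ι A, ∑ ω, p ω * f (z ω) ≤ f y}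
  have hclosed : IsClosed C := by
    simp only [C, Set.ofPred_and, Set.ofPred_forall]
    refine (isClosed_iInter fun ω => isClosed_le continuous_const (by fun_prop)).inter
      ((isClosed_le (by fun_prop) continuous_const).inter
        (isClosed_iInter fun f => isClosed_iInter fun _ =>
          isClosed_le (by fun_prop) continuous_const))
  have hcompact : IsCompact C := by
    refine (isCompact_Icc (a := (0 : Ω → ℝ)) (b := 1)).of_isClosed_subset hclosed ?_
    rintro p ⟨h0, h1, -⟩
    exact ⟨h0, fun ω => (Finset.single_le_sum (fun ω _ => h0 ω) (Finset.mem_univ ω)).trans h1⟩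
  have hne : C.Nonempty := by
    obtain ⟨p, h0, h1, -, h3⟩ := h 1 one_pos
    exact ⟨p, h0, h1, h3⟩
  obtain ⟨p, ⟨h0, h1, h3⟩, hmax⟩ := hcompact.exists_isMaxOn hne
    (f := fun p : Ω → ℝ => ∑ ω, p ω) (by fun_prop)
  refine ⟨p, h0, h1, ?_, h3⟩
  rw [sub_zero]
  refine le_of_forall_pos_le_add fun θ hθ => ?_
  obtain ⟨p', h0', h1', h2', h3'⟩ := h θ hθ
  have : ∑ ω, p' ω ≤ ∑ ω, p ω := hmax ⟨h0', h1', h3'⟩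
  linarith

/-- If from every state of `P` one can follow a step distribution that, with probability bounded
below, decreases a bounded rank or reaches a state that can be rounded, then every state of `P` can
be rounded. -/
theorem of_hitting {X : Type*} {val : X → ι → ℝ} {P : Set X} {r : X → ℕ} {N : ℕ} {c : ℝ}
    (hN : ∀ x ∈ P, r x ≤ N) (hval : ∀ x ∈ P, ∀ i, val x i ∈ Set.Icc (0 : ℝ) 1)
    (hc0 : 0 < c) (hc1 : c ≤ 1)
    (hstep : ∀ x ∈ P, ∃ (κ : Type) (_ : Fintype κ) (q : κ → ℝ) (s : κ → X), (∀ k, 0 ≤ q k) ∧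
      ∑ k, q k = 1 ∧ (∀ f ∈ testFunctions ι A, ∑ k, q k * f (val (s k)) ≤ f (val x)) ∧
      (∀ k, s k ∈ P ∨ RoundsUpTo A z (val (s k)) 0) ∧
      ∃ k, c ≤ q k ∧ (RoundsUpTo A z (val (s k)) 0 ∨ (s k ∈ P ∧ r (s k) < r x)))
    {x : X} (hx : x ∈ P) : RoundsUpTo A z (val x) 0 := by
  classical
  have hcn : ∀ n, c ^ n ≤ 1 := fun n => pow_le_one₀ hc0.le hc1
  -- From rank below `n`, favourable steps alone lead to a roundable state with probability at least
  -- `c ^ n`, and on that event nothing is abandoned.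
  have inner : ∀ d, 0 ≤ d → (∀ x ∈ P, RoundsUpTo A z (val x) d) → ∀ n, ∀ x ∈ P, r x < n →
      RoundsUpTo A z (val x) ((1 - c ^ n) * d) := by
    intro d hd hPd n
    induction n with
    | zero => exact fun x _ hr => absurd hr (Nat.not_lt_zero _)
    | succ n ih =>
      intro x hx hr
      obtain ⟨κ, _, q, s, hq, hq1, hs, hall, k₀, hk₀, hk₀'⟩ := hstep x hx
      have h0 : 0 ≤ (1 - c ^ n) * d := mul_nonneg (by linarith [hcn n]) hd
      have hgood : RoundsUpTo A z (val (s k₀)) ((1 - c ^ n) * d) :=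
        hk₀'.elim (fun h => h.mono h0) fun h => ih _ h.1 (by omega)
      have := mix hq hq1 hs (θ := fun k => if k = k₀ then (1 - c ^ n) * d else d) fun k => by
        by_cases h : k = k₀
        · subst h; simpa using hgood
        · simp only [h, if_false]
          exact (hall k).elim (fun h => hPd _ h) fun h => h.mono hd
      refine this.mono ?_
      have e : ∀ k, q k * (if k = k₀ then (1 - c ^ n) * d else d) =
          q k * d - if k = k₀ then q k * (c ^ n * d) else 0 := by
        intro k; split_ifs <;> ring
      simp_rw [e, Finset.sum_sub_distrib, ← Finset.sum_mul, hq1]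
      simp only [Finset.sum_ite_eq', Finset.mem_univ, if_true]
      have : 0 ≤ c ^ n * d := by positivity
      rw [pow_succ c n]
      nlinarith
  set c' := 1 - c ^ (N + 1) with hc'
  have hc'0 : 0 ≤ c' := by linarith [hcn (N + 1)]
  have hc'1 : c' < 1 := by linarith [pow_pos hc0 (N + 1)]
  -- The ranks are bounded by `N`, so the same factor serves all states and the abandoned mass
  -- decays geometrically.
  have outer : ∀ j : ℕ, ∀ x ∈ P, RoundsUpTo A z (val x) (c' ^ j) := by
    intro j
    induction j with
    | zero => intro x hx; simpa using one (hval x hx)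
    | succ j ih =>
      intro x hx
      rw [pow_succ']
      exact inner _ (pow_nonneg hc'0 j) ih (N + 1) x hx (Nat.lt_succ_of_le (hN x hx))
  refine closure fun θ hθ => ?_
  obtain ⟨j, hj⟩ := exists_pow_lt_of_lt_one hθ hc'1
  exact (outer j x hx).mono hj.le

end RoundsUpTo

/-! ### Elementary rounding moves -/

namespace RoundsUpTo

variable {ι Ω : Type*} [Fintype ι] [Fintype Ω] {K : ℝ} {z : Ω → ι → ℝ} {y : ι → ℝ}

/-- Coordinate `j` becomes `1` with probability `y j`. An increment with a single nonzero coordinate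
is sub-isotropic with constant `1`. -/
theorem of_update [DecidableEq ι] (hK : 1 ≤ K) (hy : ∀ i, y i ∈ Set.Icc (0 : ℝ) 1) (j : ι)
    (h0 : RoundsUpTo (7 * K) z (Function.update y j 0) 0)
    (h1 : RoundsUpTo (7 * K) z (Function.update y j 1) 0) : RoundsUpTo (7 * K) z y 0 := by
  let q : Bool → ℝ := fun b => if b then y j else 1 - y j
  let Δ : Bool → ι → ℝ := fun b i => if i = j then (if b then 1 - y j else - y j) else 0
  have hyj := hy j
  have hΔ : ∀ b, ∑ i, |Δ b i| = |Δ b j| := by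
    intro b
    rw [Finset.sum_eq_single j] <;> simp +contextual [Δ]
  have hsup : ∀ b i, |Δ b i| ≤ 1 := by
    intro b i
    by_cases hi : i = j
    · cases b <;> simp only [Δ, hi, if_true, Bool.false_eq_true, if_false] <;>
        exact abs_le.mpr ⟨by linarith [hyj.1, hyj.2], by linarith [hyj.1, hyj.2]⟩
    · simp [Δ, hi]
  have hq : ∀ b, 0 ≤ q b := by
    intro b; cases b
    · exact sub_nonneg.mpr hyj.2
    · exact hyj.1
  have hq1 : ∑ b, q b = 1 := by simp [q]
  refine mix_zero hq hq1 (s := fun b => y + Δ b)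
    (testFunctions_step hK hq hq1 hy (Δ := Δ) ?_ ?_ ?_ hsup) ?_
  · intro i
    by_cases hi : i = j
    · simp [q, Δ, hi]; ring
    · simp [Δ, hi]
  · intro a
    have e : ∀ b, ∑ i, a i * Δ b i = a j * Δ b j := by
      intro b
      rw [Finset.sum_eq_single j] <;> simp +contextual [Δ]
    have e2 : ∑ i, a i ^ 2 * ∑ b, q b * Δ b i ^ 2 = a j ^ 2 * ∑ b, q b * Δ b j ^ 2 := by
      rw [Finset.sum_eq_single j] <;> simp +contextual [Δ]
    have e3 : ∑ b, q b * (a j * Δ b j) ^ 2 = a j ^ 2 * ∑ b, q b * Δ b j ^ 2 := by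
      rw [Finset.mul_sum]
      exact Finset.sum_congr rfl fun b _ => by ring
    simp_rw [e]
    rw [e2, e3]
    have : 0 ≤ a j ^ 2 * ∑ b, q b * Δ b j ^ 2 :=
      mul_nonneg (sq_nonneg _) (Finset.sum_nonneg fun b _ => mul_nonneg (hq b) (sq_nonneg _))
    nlinarith
  · intro b
    rw [hΔ]; linarith [hsup b j]
  · have e : ∀ b, y + Δ b = Function.update y j (if b then 1 else 0) := by
      intro b
      ext i
      by_cases hi : i = j
      · subst hi; cases b <;> simp [Δ]
      · simp [Δ, hi]
    intro b
    rw [e]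
    cases b
    · simpa using h0
    · simpa using h1

/-- Coordinates are rounded one at a time, independently; every possible outcome is the indicator of
a subset of `m`. -/
theorem of_support_subset [DecidableEq ι] (hK : 1 ≤ K) (hy : ∀ i, y i ∈ Set.Icc (0 : ℝ) 1)
    (m : Finset ι) (hm : ∀ i, y i ≠ 0 → i ∈ m)
    (hz : ∀ m' ⊆ m, ∃ ω, z ω = fun i => if i ∈ m' then 1 else 0) : RoundsUpTo (7 * K) z y 0 := by
  induction hn : (Finset.univ.filter fun i => y i ≠ 0 ∧ y i ≠ 1).card using Nat.strong_induction_on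
    generalizing y with
  | _ n ih =>
    by_cases h : ∃ j, y j ≠ 0 ∧ y j ≠ 1
    · obtain ⟨j, hj⟩ := h
      have hlt : ∀ s : ℝ, s = 0 ∨ s = 1 →
          (Finset.univ.filter fun i => Function.update y j s i ≠ 0 ∧
            Function.update y j s i ≠ 1).card < n := by
        intro s hs
        rw [← hn]
        refine Finset.card_lt_card ⟨fun i hi => ?_, fun hsub => ?_⟩
        · by_cases hij : i = j
          · subst hij; simp at hi; tauto
          · simpa [hij] using hi
        · have := hsub (Finset.mem_filter.mpr ⟨Finset.mem_univ j, hj⟩)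
          simp at this; tauto
      have hc : ∀ s : ℝ, s = 0 ∨ s = 1 → RoundsUpTo (7 * K) z (Function.update y j s) 0 := by
        intro s hs
        refine ih _ (hlt s hs) (fun i => ?_) (fun i hi => ?_) rfl
        · by_cases hij : i = j
          · subst hij; rcases hs with rfl | rfl <;> simp
          · simpa [hij] using hy i
        · by_cases hij : i = j
          · subst hij; exact hm _ hj.1
          · exact hm i (by simpa [hij] using hi)
      exact of_update hK hy j (hc 0 (Or.inl rfl)) (hc 1 (Or.inr rfl))
    · push Not at h
      obtain ⟨ω, hω⟩ := hz (m.filter fun i => y i = 1) (Finset.filter_subset _ _)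
      refine of_eq ω (hω.trans ?_)
      ext i
      by_cases hi : y i = 0
      · simp [hi]
      · simp [h i hi, hm i hi]

/-- A uniformly chosen coordinate of `S` is set to zero and the rest of `S` grows by `t/(t-1)`,
which preserves means. The mixed terms of the second moment form the negative square `-s²/(t-1)²`,
so sub-isotropy holds with constant `t/(t-1) ≤ 2`. -/
theorem of_delete_one [DecidableEq ι] (hK : 2 ≤ K) (hy : ∀ i, y i ∈ Set.Icc (0 : ℝ) 1)
    (S : Finset ι) (t : ℝ) (ht : (S.card : ℝ) = t) (ht2 : 2 ≤ t)
    (hyS : ∀ i ∈ S, y i * (t / (t - 1)) ≤ 1)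
    (h : ∀ j ∈ S, RoundsUpTo (7 * K) z
      (fun i => if i ∈ S then if i = j then 0 else y i * (t / (t - 1)) else y i) 0) :
    RoundsUpTo (7 * K) z y 0 := by
  have ht1 : 0 < t - 1 := by linarith
  have ht0 : 0 < t := by linarith
  let q : S → ℝ := fun _ => 1 / t
  let Δ : S → ι → ℝ := fun j i =>
    if i ∈ S then y i / (t - 1) - (if i = j then y i * (t / (t - 1)) else 0) else 0
  have hq : ∀ j, 0 ≤ q j := fun _ => by positivity
  have hq1 : ∑ j, q j = 1 := by
    simp [q, ht]; field_simp
  have hsumΔ : ∀ (a : ι → ℝ) (j : S), ∑ i, a i * Δ j i =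
      (∑ i ∈ S, a i * y i) / (t - 1) - a j * y j * (t / (t - 1)) := by
    intro a j
    have : ∀ i, a i * Δ j i = (if i ∈ S then a i * y i / (t - 1) else 0) -
        (if i = j then a j * y j * (t / (t - 1)) else 0) := by
      intro i
      by_cases hi : i ∈ S
      · by_cases hij : i = j
        · subst hij; simp [Δ]; ring
        · simp [Δ, hi, hij]; ring
      · have : i ≠ j := fun h => hi (h ▸ j.2)
        simp [Δ, hi, this]
    simp_rw [this, Finset.sum_sub_distrib]
    simp [Finset.sum_div]
  have hsq : ∀ i ∈ S, ∑ j : S, Δ j i ^ 2 = y i ^ 2 * (t / (t - 1)) := by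
    intro i hi
    have : ∀ j : S, Δ j i ^ 2 = y i ^ 2 / (t - 1) ^ 2 +
        (if j = ⟨i, hi⟩ then y i ^ 2 * (1 - 1 / (t - 1) ^ 2) else 0) := by
      intro j
      by_cases hij : j = ⟨i, hi⟩
      · subst hij; simp [Δ, hi]; field_simp; ring
      · have : i ≠ j := fun h => hij (Subtype.ext h.symm)
        simp [Δ, hi, hij, this, div_pow]
    simp_rw [this, Finset.sum_add_distrib]
    simp [ht]; field_simp; ring
  have hsup : ∀ j i, |Δ j i| ≤ 1 := by
    intro j i
    by_cases hi : i ∈ S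
    · have h1 := hyS i hi
      have h2 : y i / (t - 1) = y i * (t / (t - 1)) - y i := by field_simp; ring
      have h3 : 0 ≤ y i / (t - 1) := div_nonneg (hy i).1 ht1.le
      have h4 := hy i
      by_cases hij : i = j
      · simp only [Δ, hi, if_true, if_pos hij]
        exact abs_le.mpr ⟨by linarith [h4.2], by linarith [h4.1]⟩
      · simp only [Δ, hi, if_true, if_neg hij]
        exact abs_le.mpr ⟨by linarith [h4.2], by linarith [h4.1]⟩
    · simp [Δ, hi]
  refine mix_zero hq hq1 (s := fun j => y + Δ j)
    (testFunctions_step (by linarith) hq hq1 hy (Δ := Δ) ?_ ?_ ?_ hsup) ?_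
  · intro i
    by_cases hi : i ∈ S
    · simp only [q, ← Finset.mul_sum, Δ, hi, if_true, Finset.sum_sub_distrib]
      have : ∑ j : S, (if i = j then y i * (t / (t - 1)) else 0) = y i * (t / (t - 1)) := by
        rw [Finset.sum_eq_single ⟨i, hi⟩]
        · simp
        · intro j _ hj
          rw [if_neg fun h => hj (Subtype.ext h.symm)]
        · simp
      rw [this]
      simp [ht]; right; field_simp; ring
    · simp [Δ, hi]
  · intro a
    simp_rw [hsumΔ]
    set s := ∑ i ∈ S, a i * y i with hs
    have hs' : ∑ j : S, a j * y j = s := Finset.sum_coe_sort S fun i => a i * y i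
    have hR : ∑ i, a i ^ 2 * ∑ j, q j * Δ j i ^ 2 = 1 / (t - 1) * ∑ j : S, (a j * y j) ^ 2 := by
      rw [Finset.sum_coe_sort S fun i => (a i * y i) ^ 2, Finset.mul_sum,
        ← Finset.sum_subset (Finset.subset_univ S)]
      · refine Finset.sum_congr rfl fun i hi => ?_
        simp only [q, ← Finset.mul_sum, hsq i hi]
        field_simp
      · intro i _ hi
        simp [Δ, hi]
    have hL : ∑ j : S, q j * (s / (t - 1) - a j * y j * (t / (t - 1))) ^ 2 =
        t / (t - 1) ^ 2 * ∑ j : S, (a j * y j) ^ 2 - s ^ 2 / (t - 1) ^ 2 := by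
      have : ∀ j : S, q j * (s / (t - 1) - a j * y j * (t / (t - 1))) ^ 2 =
          s ^ 2 / (t - 1) ^ 2 / t - 2 * s / (t - 1) ^ 2 * (a j * y j) +
            t / (t - 1) ^ 2 * (a j * y j) ^ 2 := by
        intro j; simp only [q]; field_simp; ring
      simp_rw [this, Finset.sum_add_distrib, Finset.sum_sub_distrib, ← Finset.mul_sum, hs']
      simp [ht]; field_simp; ring
    rw [hR, hL]
    have h0 : 0 ≤ ∑ j : S, (a j * y j) ^ 2 := by positivity
    have h1 : t / (t - 1) ^ 2 ≤ K * (1 / (t - 1)) := by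
      rw [mul_one_div, div_le_div_iff₀ (by positivity) ht1]
      nlinarith
    have h2 : 0 ≤ s ^ 2 / (t - 1) ^ 2 := by positivity
    nlinarith
  · intro j
    -- The sum is `t/(t-1) + 2 ≤ 4`, the ℓ¹ bound that `testFunctions_step` allows.
    have h1 : ∀ i, |Δ j i| ≤ (if i ∈ S then 1 / (t - 1) else 0) + if i = j then 2 else 0 := by
      intro i
      by_cases hi : i ∈ S
      · have h4 := hy i
        by_cases hij : i = j
        · have : (0 : ℝ) ≤ 1 / (t - 1) := by positivity
          rw [if_pos hi, if_pos hij]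
          linarith [hsup j i]
        · simp only [Δ, hi, if_true, if_neg hij, sub_zero, add_zero]
          rw [abs_of_nonneg (div_nonneg h4.1 ht1.le)]
          exact div_le_div_of_nonneg_right h4.2 ht1.le
      · have : i ≠ j := fun h => hi (h ▸ j.2)
        simp [Δ, hi, this]
    refine (Finset.sum_le_sum fun i _ => h1 i).trans ?_
    rw [Finset.sum_add_distrib]
    simp [ht]
    rw [← div_eq_mul_inv]
    have : t / (t - 1) ≤ 2 := by rw [div_le_iff₀ ht1]; linarith
    linarith
  · intro j
    convert h j j.2 using 1
    ext i
    by_cases hi : i ∈ S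
    · by_cases hij : i = j
      · simp [Δ, hij]; field_simp; ring
      · simp [Δ, hi, hij]; field_simp; ring
    · simp [Δ, hi]

end RoundsUpTo

/-! ### The random walk to the boundary of the cube -/

/-- The least signed distance to a face, over all directions and coordinates, is continuous in `s`.
Either it is positive at `ε`, or it vanishes at some `s ≤ ε` by the intermediate value theorem. -/
theorem exists_scale_hitting_boundary {κ ι : Type*} [Finite κ] [Nonempty κ] [Finite ι] [Nonempty ι]
    {x : ι → ℝ} (hx : ∀ i, x i ∈ Set.Ioo (0 : ℝ) 1) (v : κ → ι → ℝ) {ε : ℝ} (hε : 0 ≤ ε) :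
    ∃ s ∈ Set.Icc 0 ε, (∀ k i, x i + s * v k i ∈ Set.Icc (0 : ℝ) 1) ∧
      (s = ε ∧ (∀ k i, x i + s * v k i ∈ Set.Ioo (0 : ℝ) 1) ∨
        ∃ k i, x i + s * v k i = 0 ∨ x i + s * v k i = 1) := by
  cases nonempty_fintype κ
  cases nonempty_fintype ι
  let g : κ × ι → ℝ → ℝ := fun p s => min (x p.2 + s * v p.1 p.2) (1 - (x p.2 + s * v p.1 p.2))
  let h : ℝ → ℝ := fun s => Finset.univ.inf' Finset.univ_nonempty fun p => g p s
  have hcont : Continuous h := by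
    refine Continuous.finset_inf'_apply _ fun p _ => ?_
    simp only [g]; fun_prop
  have hle : ∀ s k i, h s ≤ g (k, i) s := fun s k i =>
    Finset.inf'_le (fun p => g p s) (Finset.mem_univ (k, i))
  by_cases hpos : 0 < h ε
  · have : ∀ k i, x i + ε * v k i ∈ Set.Ioo (0 : ℝ) 1 := fun k i => by
      have := lt_min_iff.mp (hpos.trans_le (hle ε k i))
      exact ⟨this.1, by linarith [this.2]⟩
    exact ⟨ε, ⟨hε, le_rfl⟩, fun k i => ⟨(this k i).1.le, (this k i).2.le⟩, Or.inl ⟨rfl, this⟩⟩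
  · have h0 : 0 ≤ h 0 := by
      refine Finset.le_inf' _ _ fun p _ => ?_
      simp only [g, zero_mul, add_zero]
      exact le_min (hx p.2).1.le (by linarith [(hx p.2).2])
    obtain ⟨s, hs, hs0⟩ := intermediate_value_Icc' hε hcont.continuousOn ⟨not_lt.mp hpos, h0⟩
    refine ⟨s, hs, fun k i => ?_, Or.inr ?_⟩
    · have := le_min_iff.mp (hs0 ▸ hle s k i)
      exact ⟨this.1, by linarith [this.2]⟩
    · obtain ⟨⟨k, i⟩, -, hp⟩ := Finset.exists_mem_eq_inf' Finset.univ_nonempty fun p => g p s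
      refine ⟨k, i, ?_⟩
      have hg : g (k, i) s = 0 := hp.symm.trans hs0
      rcases min_choice (x i + s * v k i) (1 - (x i + s * v k i)) with h' | h'
      · left; rw [← h']; exact hg
      · right
        have : 1 - (x i + s * v k i) = 0 := by rw [← h']; exact hg
        linarith

namespace RoundsUpTo

variable {ι Ω : Type*} [Fintype ι] [Fintype Ω] {K : ℝ} {z : Ω → ι → ℝ}

/-- The walk adds `± s v k` with uniform sign and index until some fractional coordinate of `x`
becomes integral. The factors `c` do no harm: sub-isotropy is required for all `a`, in particular
for `a i * c i`. -/
theorem of_walk_to_boundary (hK : 1 ≤ K) {c x : ι → ℝ} (hc : ∀ i, c i ∈ Set.Icc (0 : ℝ) 1)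
    (hx : ∀ i, x i ∈ Set.Icc (0 : ℝ) 1) {m : ℕ} {v : Fin m → ι → ℝ}
    (hv0 : ∃ k i, v k i ≠ 0) (hvsupp : ∀ k i, v k i ≠ 0 → x i ∈ Set.Ioo (0 : ℝ) 1)
    (hsub : ∀ a : ι → ℝ, ∑ k, (∑ i, a i * v k i) ^ 2 ≤ K * ∑ i, a i ^ 2 * ∑ k, v k i ^ 2)
    (hbd : ∀ x' : ι → ℝ, (∀ i, x' i ∈ Set.Icc (0 : ℝ) 1) →
      (∀ i, x i ∉ Set.Ioo (0 : ℝ) 1 → x' i = x i) → x' - x ∈ Submodule.span ℝ (Set.range v) →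
      (∃ i, x i ∈ Set.Ioo (0 : ℝ) 1 ∧ x' i ∉ Set.Ioo (0 : ℝ) 1) →
      RoundsUpTo (7 * K) z (fun i => c i * x' i) 0) :
    RoundsUpTo (7 * K) z (fun i => c i * x i) 0 := by
  classical
  obtain ⟨k₀, i₀, hv0⟩ := hv0
  have hm : 0 < m := k₀.pos
  have hmR : (0 : ℝ) < m := by exact_mod_cast hm
  have : Nonempty (Fin m) := ⟨k₀⟩
  let I := {i // x i ∈ Set.Ioo (0 : ℝ) 1}
  have hI : Nonempty I := ⟨⟨i₀, hvsupp _ _ hv0⟩⟩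
  let B : ℝ := ∑ k, ∑ i, |v k i|
  have hB : ∀ k, ∑ i, |v k i| ≤ B := fun k =>
    Finset.single_le_sum (f := fun k => ∑ i, |v k i|)
      (fun k _ => Finset.sum_nonneg fun i _ => abs_nonneg _) (Finset.mem_univ k)
  have hB0 : 0 < B := (abs_pos.mpr hv0).trans_le
    ((Finset.single_le_sum (fun i _ => abs_nonneg (v k₀ i)) (Finset.mem_univ i₀)).trans (hB k₀))
  -- With this step bound every increment has ℓ¹ norm, hence also sup norm, at most one.
  let ε : ℝ := 1 / B
  have hε : 0 < ε := by positivity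
  let η : ℝ := ε * |v k₀ i₀|
  have hη : 0 < η := mul_pos hε (abs_pos.mpr hv0)
  let σ : Bool → ℝ := fun b => if b then 1 else -1
  have hσ : ∀ b, σ b ^ 2 = 1 := by intro b; cases b <;> simp [σ]
  have hσa : ∀ b, |σ b| = 1 := by intro b; cases b <;> simp [σ]
  let P : Set (ι → ℝ) := {x' | (∀ i, x' i ∈ Set.Icc (0 : ℝ) 1) ∧
    (∀ i, x i ∉ Set.Ioo (0 : ℝ) 1 → x' i = x i) ∧ x' - x ∈ Submodule.span ℝ (Set.range v) ∧
    ∀ i, x i ∈ Set.Ioo (0 : ℝ) 1 → x' i ∈ Set.Ioo (0 : ℝ) 1}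
  have hxP : x ∈ P := ⟨hx, fun _ _ => rfl, by simp, fun _ h => h⟩
  let q : Fin m × Bool → ℝ := fun _ => 1 / (2 * m)
  have hq : ∀ p, 0 ≤ q p := fun _ => by positivity
  have hq1 : ∑ p, q p = 1 := by simp [q]; field_simp
  -- The rank counts the upward moves by `η` for which coordinate `i₀` still has room. One of the
  -- `2m` choices makes such a move, unless the scale was cut short because some choice reaches the
  -- boundary.
  refine of_hitting (val := fun x i => c i * x i) (P := P) (r := fun x' => ⌊(1 - x' i₀) / η⌋₊)
    (N := ⌊1 / η⌋₊) (c := 1 / (2 * m)) ?_ ?_ (by positivity) ?_ ?_ hxP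
  · intro x' hx'
    exact Nat.floor_mono (div_le_div_of_nonneg_right (by linarith [(hx'.1 i₀).1]) hη.le)
  · intro x' hx' i
    exact ⟨mul_nonneg (hc i).1 (hx'.1 i).1, mul_le_one₀ (hc i).2 (hx'.1 i).1 (hx'.1 i).2⟩
  · rw [div_le_one (by positivity)]
    have : (1 : ℝ) ≤ m := by exact_mod_cast hm
    linarith
  intro x' hx'
  obtain ⟨s, ⟨hs0, hsε⟩, hcube, hcase⟩ := exists_scale_hitting_boundary
    (x := fun i : I => x' i) (fun i => hx'.2.2.2 i i.2)
    (fun (p : Fin m × Bool) (i : I) => σ p.2 * v p.1 i) hε.le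
  let ch : Fin m × Bool → ι → ℝ := fun p i => x' i + s * (σ p.2 * v p.1 i)
  have hvz : ∀ k i, x i ∉ Set.Ioo (0 : ℝ) 1 → v k i = 0 := fun k i hi => by
    by_contra h; exact hi (hvsupp k i h)
  have hchoff : ∀ p i, x i ∉ Set.Ioo (0 : ℝ) 1 → ch p i = x i := by
    intro p i hi
    simp only [ch, hvz _ i hi, mul_zero, add_zero]
    exact hx'.2.1 i hi
  have hchcube : ∀ p i, ch p i ∈ Set.Icc (0 : ℝ) 1 := by
    intro p i
    by_cases hi : x i ∈ Set.Ioo (0 : ℝ) 1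
    · exact hcube p ⟨i, hi⟩
    · rw [hchoff p i hi]; exact hx i
  have hchspan : ∀ p, ch p - x ∈ Submodule.span ℝ (Set.range v) := by
    intro p
    have : ch p - x = (x' - x) + (s * σ p.2) • v p.1 := by
      ext i; simp [ch]; ring
    rw [this]
    exact add_mem hx'.2.2.1 (Submodule.smul_mem _ _ (Submodule.subset_span ⟨p.1, rfl⟩))
  have hgood : ∀ p, (∃ i, x i ∈ Set.Ioo (0 : ℝ) 1 ∧ ch p i ∉ Set.Ioo (0 : ℝ) 1) →
      RoundsUpTo (7 * K) z (fun i => c i * ch p i) 0 := fun p =>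
    hbd _ (hchcube p) (hchoff p) (hchspan p)
  have hall : ∀ p, ch p ∈ P ∨ RoundsUpTo (7 * K) z (fun i => c i * ch p i) 0 := by
    intro p
    by_cases h : ∀ i, x i ∈ Set.Ioo (0 : ℝ) 1 → ch p i ∈ Set.Ioo (0 : ℝ) 1
    · exact Or.inl ⟨hchcube p, hchoff p, hchspan p, h⟩
    · push Not at h
      exact Or.inr (hgood p h)
  refine ⟨Fin m × Bool, inferInstance, q, ch, hq, hq1, ?_, hall, ?_⟩
  · let Δ : Fin m × Bool → ι → ℝ := fun p i => c i * (s * (σ p.2 * v p.1 i))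
    have hΔabs : ∀ p i, |Δ p i| ≤ ε * |v p.1 i| := by
      intro p i
      simp only [Δ, abs_mul, hσa, one_mul, abs_of_nonneg (hc i).1, abs_of_nonneg hs0]
      have h1 : s * |v p.1 i| ≤ ε * |v p.1 i| := mul_le_mul_of_nonneg_right hsε (abs_nonneg _)
      have h2 : 0 ≤ s * |v p.1 i| := by positivity
      exact (mul_le_of_le_one_left h2 (hc i).2).trans h1
    have hl1 : ∀ p, ∑ i, |Δ p i| ≤ 1 := by
      intro p
      calc ∑ i, |Δ p i| ≤ ∑ i, ε * |v p.1 i| := Finset.sum_le_sum fun i _ => hΔabs p i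
        _ ≤ ε * B := by
          rw [← Finset.mul_sum]; exact mul_le_mul_of_nonneg_left (hB _) hε.le
        _ = 1 := by simp only [ε]; field_simp
    have e : ∀ p, (fun i => c i * ch p i) = (fun i => c i * x' i) + Δ p := by
      intro p; ext i; simp only [ch, Δ, Pi.add_apply]; ring
    simp_rw [e]
    refine testFunctions_step hK hq hq1 (fun i => ?_) ?_ ?_ (fun p => (hl1 p).trans (by norm_num))
      fun p i => (Finset.single_le_sum (fun i _ => abs_nonneg (Δ p i)) (Finset.mem_univ i)).trans
        (hl1 p)
    · exact ⟨mul_nonneg (hc i).1 (hx'.1 i).1, mul_le_one₀ (hc i).2 (hx'.1 i).1 (hx'.1 i).2⟩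
    · intro i
      simp [Fintype.sum_prod_type, q, Δ, σ]
    · intro a
      have e1 : ∀ p, (∑ i, a i * Δ p i) ^ 2 = s ^ 2 * (∑ i, (a i * c i) * v p.1 i) ^ 2 := by
        intro p
        have : ∑ i, a i * Δ p i = s * σ p.2 * ∑ i, (a i * c i) * v p.1 i := by
          rw [Finset.mul_sum]
          exact Finset.sum_congr rfl fun i _ => by simp only [Δ]; ring
        rw [this, mul_pow, mul_pow, hσ, mul_one]
      have e2 : ∀ p i, Δ p i ^ 2 = s ^ 2 * (c i ^ 2 * v p.1 i ^ 2) := by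
        intro p i
        simp only [Δ, mul_pow, hσ]; ring
      have h := hsub fun i => a i * c i
      have e3 : ∑ p, q p * (∑ i, a i * Δ p i) ^ 2 =
          s ^ 2 / m * ∑ k, (∑ i, (a i * c i) * v k i) ^ 2 := by
        simp_rw [e1, Fintype.sum_prod_type, q, Finset.mul_sum]
        refine Finset.sum_congr rfl fun k _ => ?_
        simp; field_simp
      have e4 : ∀ i, a i ^ 2 * ∑ p, q p * Δ p i ^ 2 =
          s ^ 2 / m * ((a i * c i) ^ 2 * ∑ k, v k i ^ 2) := by
        intro i
        simp_rw [e2, Fintype.sum_prod_type, q, Finset.mul_sum]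
        refine Finset.sum_congr rfl fun k _ => ?_
        simp; field_simp
      rw [e3]
      simp_rw [e4, ← Finset.mul_sum]
      calc _ ≤ s ^ 2 / m * (K * ∑ i, (a i * c i) ^ 2 * ∑ k, v k i ^ 2) :=
            mul_le_mul_of_nonneg_left h (by positivity)
        _ = _ := by ring
  · rcases hcase with ⟨hs, hin⟩ | ⟨p, i, hi⟩
    · let b : Bool := decide (0 ≤ v k₀ i₀)
      have hb : σ b * v k₀ i₀ = |v k₀ i₀| := by
        by_cases h : 0 ≤ v k₀ i₀
        · simp [σ, b, h, abs_of_nonneg h]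
        · simp [σ, b, h, abs_of_neg (not_le.mp h)]
      have hch : ch (k₀, b) i₀ = x' i₀ + η := by simp only [ch, hb, hs, η]
      refine ⟨(k₀, b), le_rfl, Or.inr ⟨⟨hchcube _, hchoff _, hchspan _, fun i hi => hin _ ⟨i, hi⟩⟩,
        ?_⟩⟩
      have h1 := (hin (k₀, b) ⟨i₀, hvsupp _ _ hv0⟩).2
      have h2 : x' i₀ + η < 1 := by rw [← hch]; exact h1
      have h3 : (1 - ch (k₀, b) i₀) / η = (1 - x' i₀) / η - 1 := by
        rw [hch]; field_simp; ring
      have h4 : 1 ≤ (1 - x' i₀) / η := by rw [one_le_div hη]; linarith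
      simp only [h3, Nat.floor_sub_one]
      exact Nat.sub_lt (Nat.floor_pos.mpr h4) one_pos
    · refine ⟨p, le_rfl, Or.inl (hgood p ⟨i, i.2, fun h => ?_⟩)⟩
      have hi' : ch p i = 0 ∨ ch p i = 1 := hi
      rcases hi' with h' | h'
      · exact h.1.ne' h'
      · exact h.2.ne h'

end RoundsUpTo

/-! ### Counting degree-two vertices by non-backtracking walks -/

namespace SimpleGraph

variable {V : Type*} (H : SimpleGraph V)

open Classical in
/-- The non-backtracking continuation of a dart `(u, v)`: the dart from `v` to a neighbour of `v`
other than `u`, if there is one. -/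
noncomputable def nextDart (p : V × V) : V × V :=
  (p.2, if h : ∃ w, H.Adj p.2 w ∧ w ≠ p.1 then h.choose else p.1)

theorem iterate_nextDart_fst (p : V × V) (i : ℕ) :
    (H.nextDart^[i + 1] p).1 = (H.nextDart^[i] p).2 := by
  rw [Function.iterate_succ_apply']; rfl

variable {H} [Fintype V] [DecidableEq V] [DecidableRel H.Adj]

theorem nextDart_spec {p : V × V} (hadj : H.Adj p.1 p.2) (hdeg : H.degree p.2 = 2) :
    H.Adj p.2 (H.nextDart p).2 ∧ (H.nextDart p).2 ≠ p.1 ∧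
      ∀ w, H.Adj p.2 w → w = p.1 ∨ w = (H.nextDart p).2 := by
  obtain ⟨a, b, hab, hN⟩ := Finset.card_eq_two.mp hdeg
  have hmem : ∀ w, H.Adj p.2 w ↔ w = a ∨ w = b := by
    intro w; rw [← mem_neighborFinset, hN]; simp
  have hex : ∃ w, H.Adj p.2 w ∧ w ≠ p.1 := by
    by_cases h : a = p.1
    · exact ⟨b, (hmem b).mpr (Or.inr rfl), fun h' => hab (h.trans h'.symm)⟩
    · exact ⟨a, (hmem a).mpr (Or.inl rfl), h⟩
  have he : (H.nextDart p).2 = hex.choose := dif_pos hex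
  have h1 := hex.choose_spec
  rw [← he] at h1
  refine ⟨h1.1, h1.2, fun w hw => ?_⟩
  have h2 := (hmem _).mp h1.1
  have h3 := (hmem _).mp hadj.symm
  have h4 := (hmem _).mp hw
  have h5 := h1.2
  grind

/-- Through a vertex of degree two, a non-backtracking walk can be reversed. -/
theorem nextDart_injective {p p' : V × V} (hadj : H.Adj p.1 p.2) (hdeg : H.degree p.2 = 2)
    (hadj' : H.Adj p'.1 p'.2) (hdeg' : H.degree p'.2 = 2) (h : H.nextDart p = H.nextDart p') :
    p = p' := by
  have h1 : p.2 = p'.2 := congrArg Prod.fst h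
  have h2 := nextDart_spec hadj hdeg
  have h3 := nextDart_spec hadj' hdeg'
  rw [← h] at h3
  refine Prod.ext ?_ h1
  exact ((h3.2.2 p.1 (h1 ▸ hadj.symm)).resolve_right h2.2.1.symm)

theorem iterate_nextDart_adj {p : V × V} (hadj : H.Adj p.1 p.2) {j : ℕ}
    (hdeg : ∀ i < j, H.degree (H.nextDart^[i] p).2 = 2) :
    H.Adj (H.nextDart^[j] p).1 (H.nextDart^[j] p).2 := by
  induction j with
  | zero => exact hadj
  | succ j ih =>
    rw [Function.iterate_succ_apply']
    exact (nextDart_spec (ih fun i hi => hdeg i (by omega)) (hdeg j (by omega))).1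

theorem iterate_nextDart_injective {j : ℕ} {p p' : V × V} (hadj : H.Adj p.1 p.2)
    (hdeg : ∀ i < j, H.degree (H.nextDart^[i] p).2 = 2) (hadj' : H.Adj p'.1 p'.2)
    (hdeg' : ∀ i < j, H.degree (H.nextDart^[i] p').2 = 2)
    (h : H.nextDart^[j] p = H.nextDart^[j] p') : p = p' := by
  induction j with
  | zero => exact h
  | succ j ih =>
    refine ih (fun i hi => hdeg i (by omega)) (fun i hi => hdeg' i (by omega)) ?_
    rw [Function.iterate_succ_apply', Function.iterate_succ_apply'] at h
    exact nextDart_injective (iterate_nextDart_adj hadj fun i hi => hdeg i (by omega))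
      (hdeg j (by omega)) (iterate_nextDart_adj hadj' fun i hi => hdeg' i (by omega))
      (hdeg' j (by omega)) h

/-- At the first repetition `f i = f j`, the vertex `f (j - 1)` is a neighbour of `f i`. If `i > 0`
it equals `f (i - 1)` or `f (i + 1)`, an earlier repetition. So `i = 0`, and the vertices before `j`
form a cycle without further neighbours. -/
theorem exists_closed_of_not_injOn {f : ℕ → V} {t : ℕ} (hdeg : ∀ i < t, H.degree (f i) = 2)
    (hadj : ∀ i, i + 1 < t → H.Adj (f i) (f (i + 1))) (hne : ∀ i, i + 2 < t → f (i + 2) ≠ f i)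
    (hnb : ∀ i, i + 2 < t → ∀ w, H.Adj (f (i + 1)) w → w = f i ∨ w = f (i + 2))
    (hinj : ¬ Set.InjOn f (Set.Iio t)) :
    ∃ S : Finset V, S.Nonempty ∧ S.card ≤ t ∧ (∀ v ∈ S, H.degree v = 2) ∧
      ∀ v ∈ S, ∀ w, H.Adj v w → w ∈ S := by
  have hex : ∃ j, j < t ∧ ∃ i < j, f i = f j := by
    simp only [Set.InjOn, Set.mem_Iio, not_forall] at hinj
    obtain ⟨a, ha, b, hb, hab, hne⟩ := hinj
    rcases lt_or_gt_of_ne hne with h | h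
    · exact ⟨b, hb, a, h, hab⟩
    · exact ⟨a, ha, b, h, hab.symm⟩
  obtain ⟨j, ⟨hjt, i, hij, hfij⟩, hmin⟩ : ∃ j, (j < t ∧ ∃ i < j, f i = f j) ∧
      ∀ k < j, ¬ (k < t ∧ ∃ i < k, f i = f k) :=
    ⟨Nat.find hex, Nat.find_spec hex, fun k hk => Nat.find_min hex hk⟩
  have hdist : ∀ a b, a < j → b < j → f a = f b → a = b := by
    intro a b ha hb hab
    by_contra hne
    rcases lt_or_gt_of_ne hne with h | h
    · exact hmin b hb ⟨by omega, a, h, hab⟩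
    · exact hmin a ha ⟨by omega, b, h, hab.symm⟩
  have hj1 : j ≠ i + 1 := by
    rintro rfl
    exact (hadj i hjt).ne hfij
  have hj2 : j ≠ i + 2 := by
    rintro rfl
    exact hne i hjt hfij.symm
  obtain ⟨k, rfl⟩ : ∃ k, j = i + 3 + k := ⟨j - (i + 3), by omega⟩
  have hlast : H.Adj (f i) (f (i + 2 + k)) := by
    rw [hfij, show i + 3 + k = i + 2 + k + 1 by ring]
    exact (hadj (i + 2 + k) (by omega)).symm
  rcases Nat.eq_zero_or_pos i with rfl | hi
  · have hN : H.neighborFinset (f 0) = {f 1, f (0 + 2 + k)} := by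
      symm
      refine Finset.eq_of_subset_of_card_le ?_ ?_
      · intro w hw
        rw [mem_neighborFinset]
        rcases Finset.mem_insert.mp hw with rfl | hw
        · exact hadj 0 (by omega)
        · rw [Finset.mem_singleton.mp hw]; exact hlast
      · rw [card_neighborFinset_eq_degree, hdeg 0 (by omega), Finset.card_pair]
        intro h
        have := hdist _ _ (by omega) (by omega) h
        omega
    refine ⟨(Finset.range (0 + 3 + k)).image f, ⟨f 0, Finset.mem_image_of_mem _ (by simp)⟩,
      Finset.card_image_le.trans (by simp; omega), ?_, ?_⟩
    · intro v hv
      obtain ⟨a, ha, rfl⟩ := Finset.mem_image.mp hv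
      exact hdeg a (by have := Finset.mem_range.mp ha; omega)
    · intro v hv w hw
      obtain ⟨a, ha, rfl⟩ := Finset.mem_image.mp hv
      have ha := Finset.mem_range.mp ha
      rcases a with _ | a
      · rw [← mem_neighborFinset, hN] at hw
        rcases Finset.mem_insert.mp hw with rfl | hw
        · exact Finset.mem_image_of_mem _ (by simp; omega)
        · rw [Finset.mem_singleton.mp hw]; exact Finset.mem_image_of_mem _ (by simp)
      · rcases hnb a (by omega) w hw with rfl | rfl
        · exact Finset.mem_image_of_mem _ (by simp; omega)
        · by_cases h : a + 2 = 0 + 3 + k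
          · rw [h, ← hfij]; exact Finset.mem_image_of_mem _ (by simp)
          · exact Finset.mem_image_of_mem _ (by simp; omega)
  · obtain ⟨i, rfl⟩ : ∃ i', i = i' + 1 := ⟨i - 1, by omega⟩
    exfalso
    rcases hnb i (by omega) _ hlast with h | h
    · have := hdist _ _ (by omega) (by omega) h
      omega
    · have := hdist _ _ (by omega) (by omega) h
      omega

/-- Double counting: the `2 d₂` darts that leave degree-two vertices inject into pairs of a step
count below `t - 1` and a dart that enters a vertex of another degree. -/
theorem two_mul_card_degree_two_le {t : ℕ} (ht : 1 ≤ t)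
    (hpath : ¬ ∃ f : ℕ → V, Set.InjOn f (Set.Iio t) ∧ (∀ i < t, H.degree (f i) = 2) ∧
      ∀ i, i + 1 < t → H.Adj (f i) (f (i + 1)))
    (hclosed : ¬ ∃ S : Finset V, S.Nonempty ∧ S.card ≤ t ∧ (∀ v ∈ S, H.degree v = 2) ∧
      ∀ v ∈ S, ∀ w, H.Adj v w → w ∈ S) :
    2 * (Finset.univ.filter fun v => H.degree v = 2).card ≤
      (t - 1) * ∑ v with H.degree v ≠ 2, H.degree v := by
  let D := Finset.univ.filter fun p : V × V => H.Adj p.1 p.2 ∧ H.degree p.1 = 2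
  let D' := Finset.univ.filter fun p : V × V => H.Adj p.1 p.2 ∧ H.degree p.2 ≠ 2
  have hD : D.card = 2 * (Finset.univ.filter fun v => H.degree v = 2).card := by
    simp only [D, Finset.card_filter, Fintype.sum_prod_type, Finset.mul_sum]
    refine Finset.sum_congr rfl fun v _ => ?_
    by_cases h : H.degree v = 2
    · simp only [h, and_true, if_true, mul_one]
      rw [← h, ← card_neighborFinset_eq_degree, ← Finset.card_filter]
      congr 1; ext; simp
    · simp [h]
  have hD' : D'.card = ∑ v with H.degree v ≠ 2, H.degree v := by
    simp only [D', Finset.card_filter, Fintype.sum_prod_type_right, Finset.sum_filter]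
    refine Finset.sum_congr rfl fun v _ => ?_
    by_cases h : H.degree v = 2
    · simp [h]
    · simp only [h, not_false_eq_true, and_true, if_true, ne_eq]
      rw [← card_neighborFinset_eq_degree, ← Finset.card_filter]
      congr 1; ext; simp [adj_comm]
  -- Otherwise the tail and the first `t - 1` heads are `t` successive degree-two vertices: a path
  -- if distinct, and the source of a closed set if not.
  have hend : ∀ p ∈ D, ∃ j, j < t - 1 ∧ H.degree (H.nextDart^[j] p).2 ≠ 2 := by
    intro p hp
    obtain ⟨hadj, hdeg⟩ := (Finset.mem_filter.mp hp).2
    by_contra! hall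
    let f : ℕ → V := fun i => (H.nextDart^[i] p).1
    have hf1 : ∀ i, f (i + 1) = (H.nextDart^[i] p).2 :=
      iterate_nextDart_fst H p
    have hfdeg : ∀ i < t, H.degree (f i) = 2 := by
      rintro (_ | i) hi
      · exact hdeg
      · rw [hf1]; exact hall i (by omega)
    have hfadj : ∀ i, i + 1 < t → H.Adj (f i) (f (i + 1)) := by
      intro i hi
      rw [hf1]
      exact iterate_nextDart_adj hadj fun k hk => hall k (by omega)
    have hspec : ∀ i, i + 2 < t → _ := fun i hi => nextDart_spec
      (iterate_nextDart_adj hadj (j := i) fun k hk => hall k (by omega)) (hall i (by omega))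
    have hf2 : ∀ i, (H.nextDart (H.nextDart^[i] p)).2 = f (i + 2) := by
      intro i
      rw [hf1 (i + 1), Function.iterate_succ_apply']
    by_cases hinj : Set.InjOn f (Set.Iio t)
    · exact hpath ⟨f, hinj, hfdeg, hfadj⟩
    · refine hclosed (exists_closed_of_not_injOn hfdeg hfadj (fun i hi => ?_)
        (fun i hi w hw => ?_) hinj)
      · rw [← hf2]; exact (hspec i hi).2.1
      · rw [hf1] at hw
        rw [← hf2]; exact (hspec i hi).2.2 w hw
  classical
  let j : V × V → ℕ := fun p => if h : ∃ j, j < t - 1 ∧ H.degree (H.nextDart^[j] p).2 ≠ 2 then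
    Nat.find h else 0
  have hj : ∀ p ∈ D, j p < t - 1 ∧ H.degree (H.nextDart^[j p] p).2 ≠ 2 ∧
      ∀ i < j p, H.degree (H.nextDart^[i] p).2 = 2 := by
    intro p hp
    have h := hend p hp
    have e : j p = Nat.find h := dif_pos h
    rw [e]
    refine ⟨(Nat.find_spec h).1, (Nat.find_spec h).2, fun i hi => ?_⟩
    by_contra hne
    exact Nat.find_min h hi ⟨hi.trans (Nat.find_spec h).1, hne⟩
  have hadjD : ∀ p ∈ D, H.Adj p.1 p.2 := fun p hp => (Finset.mem_filter.mp hp).2.1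
  have hcard : D.card ≤ (Finset.range (t - 1) ×ˢ D').card := by
    refine Finset.card_le_card_of_injOn (fun p => (j p, H.nextDart^[j p] p)) ?_ ?_
    · intro p hp
      obtain ⟨h1, h2, h3⟩ := hj p hp
      refine Finset.mem_product.mpr ⟨Finset.mem_range.mpr h1, ?_⟩
      exact Finset.mem_filter.mpr ⟨Finset.mem_univ _, iterate_nextDart_adj (hadjD p hp) h3, h2⟩
    · intro p hp p' hp' h
      obtain ⟨h1, h2⟩ := Prod.mk.inj h
      have h3 := (hj p hp).2.2
      rw [h1] at h3 h2
      exact iterate_nextDart_injective (hadjD p hp) h3 (hadjD p' hp') (hj p' hp').2.2 h2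
  rwa [hD, Finset.card_product, Finset.card_range, hD'] at hcard

/-- The edge bound, for graphs that need not be connected: instead of not being a cycle, the graph
has no small union of components in which all degrees are `2`. -/
theorem mul_card_degree_ge_two_le_card_edgeFinset {t : ℕ} (ht : 1 ≤ t)
    (hpath : ¬ ∃ f : ℕ → V, Set.InjOn f (Set.Iio t) ∧ (∀ i < t, H.degree (f i) = 2) ∧
      ∀ i, i + 1 < t → H.Adj (f i) (f (i + 1)))
    (hclosed : ¬ ∃ S : Finset V, S.Nonempty ∧ S.card ≤ t ∧ (∀ v ∈ S, H.degree v = 2) ∧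
      ∀ v ∈ S, ∀ w, H.Adj v w → w ∈ S) :
    (1 + 1 / (4 * (t : ℝ))) * (((Finset.univ.filter fun v : V => H.degree v = 2).card : ℝ) +
      ((Finset.univ.filter fun v : V => 3 ≤ H.degree v).card : ℝ)) ≤ (H.edgeFinset.card : ℝ) := by
  have h1 := two_mul_card_degree_two_le ht hpath hclosed
  have h2 := H.sum_degrees_eq_twice_card_edges
  rw [← Finset.sum_filter_add_sum_filter_not _ fun v => H.degree v = 2] at h2
  have h3 : ∑ v with H.degree v = 2, H.degree v =
      2 * (Finset.univ.filter fun v => H.degree v = 2).card := by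
    rw [Finset.sum_congr rfl fun v hv => (Finset.mem_filter.mp hv).2]
    simp [mul_comm]
  have h4 : 3 * (Finset.univ.filter fun v => 3 ≤ H.degree v).card ≤
      ∑ v with H.degree v ≠ 2, H.degree v := by
    calc 3 * (Finset.univ.filter fun v => 3 ≤ H.degree v).card
        = ∑ v with 3 ≤ H.degree v, 3 := by simp [mul_comm]
      _ ≤ ∑ v with 3 ≤ H.degree v, H.degree v :=
          Finset.sum_le_sum fun v hv => (Finset.mem_filter.mp hv).2
      _ ≤ _ := Finset.sum_le_sum_of_subset fun v hv => by
          have := (Finset.mem_filter.mp hv).2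
          exact Finset.mem_filter.mpr ⟨Finset.mem_univ _, by omega⟩
  rw [h3] at h2
  set X := ∑ v with H.degree v ≠ 2, H.degree v
  set d₂ := (Finset.univ.filter fun v => H.degree v = 2).card
  set d₃ := (Finset.univ.filter fun v => 3 ≤ H.degree v).card
  have htR : (1 : ℝ) ≤ t := by exact_mod_cast ht
  have h1' : 2 * (d₂ : ℝ) ≤ (t - 1) * X := by
    have := (Nat.cast_le (α := ℝ)).mpr h1
    push_cast [Nat.cast_sub ht] at this
    exact this
  have h2' : 2 * (d₂ : ℝ) + X = 2 * H.edgeFinset.card := by exact_mod_cast h2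
  have h4' : 3 * (d₃ : ℝ) ≤ X := by exact_mod_cast h4
  have hX : (0 : ℝ) ≤ X := Nat.cast_nonneg X
  rw [show (1 + 1 / (4 * (t : ℝ))) * (d₂ + d₃) = (4 * t + 1) * (d₂ + d₃) / (4 * t) by field_simp,
    div_le_iff₀ (by positivity)]
  -- What remains is `d₂ + (4t + 1) d₃ ≤ 2 t X`, and the left side is at most `(11 t - 1) X / 6`.
  nlinarith

end SimpleGraph

/-! ### The edge bound for connected graphs -/

namespace SimpleGraph

theorem exists_walk_support_eq_map {V : Type*} {G : SimpleGraph V} (f : ℕ → V) (n : ℕ)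
    (hadj : ∀ i < n, G.Adj (f i) (f (i + 1))) :
    ∃ p : G.Walk (f 0) (f n), p.support = (List.range (n + 1)).map f := by
  induction n with
  | zero => exact ⟨Walk.nil, by simp⟩
  | succ n ih =>
    obtain ⟨p, hp⟩ := ih fun i hi => hadj i (by omega)
    refine ⟨p.concat (hadj n (by omega)), ?_⟩
    rw [Walk.support_concat, hp, List.range_succ (n := n + 1)]
    simp

/-- The cycle that covers the component of `v` covers all vertices; comparing degrees, it uses all
edges. -/
theorem isCycleGraph_of_forall_degree_eq_two {V : Type*} [Fintype V] {G : SimpleGraph V}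
    [DecidableRel G.Adj] (hconn : G.Connected) (hdeg : ∀ v, G.degree v = 2) : IsCycleGraph G := by
  have hncard : ∀ v, (G.neighborSet v).ncard = 2 := by
    intro v
    rw [← hdeg v, ← card_neighborSet_eq_degree, Set.ncard_eq_toFinset_card', Set.toFinset_card]
  have hcyc : G.IsCycles := fun v _ => hncard v
  obtain ⟨v⟩ := hconn.nonempty
  have hne : (G.neighborSet v).Nonempty := by
    rw [← Set.ncard_pos, hncard]; norm_num
  obtain ⟨p, hp, hverts⟩ := hcyc.exists_cycle_toSubgraph_verts_eq_connectedComponentSupp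
    (c := G.connectedComponentMk v) (ConnectedComponent.mem_supp_iff _ _ |>.mpr rfl) hne
  have hmem : ∀ u, u ∈ p.support := by
    intro u
    rw [← Walk.mem_verts_toSubgraph, hverts, ConnectedComponent.mem_supp_iff]
    exact ConnectedComponent.sound (hconn.preconnected u v)
  refine ⟨v, p, hp, ?_⟩
  refine Subgraph.ext (by ext u; simp [hmem u]) ?_
  ext u w
  simp only [Subgraph.top_adj]
  refine ⟨fun h => h.adj_sub, fun h => ?_⟩
  have hsub : p.toSubgraph.neighborSet u ⊆ G.neighborSet u := p.toSubgraph.neighborSet_subset u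
  have heq : p.toSubgraph.neighborSet u = G.neighborSet u :=
    Set.eq_of_subset_of_ncard_le hsub
      (by rw [hncard, hp.ncard_neighborSet_toSubgraph_eq_two (hmem u)])
  have : w ∈ p.toSubgraph.neighborSet u := heq ▸ h
  exact this

theorem Connected.mul_card_degree_ge_two_le_card_edgeFinset {V : Type*} [Fintype V] [DecidableEq V]
    {G : SimpleGraph V} [DecidableRel G.Adj] {t : ℕ} (ht : 2 ≤ t) (hconn : G.Connected)
    (hcycle : ¬ IsCycleGraph G)
    (hpath : ¬ ∃ (u v : V) (p : G.Walk u v), p.IsPath ∧ p.support.length = t ∧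
      ∀ w ∈ p.support, G.degree w = 2) :
    (1 + 1 / (4 * (t : ℝ))) * (((Finset.univ.filter fun v : V => G.degree v = 2).card : ℝ) +
      ((Finset.univ.filter fun v : V => 3 ≤ G.degree v).card : ℝ)) ≤ (G.edgeFinset.card : ℝ) := by
  refine SimpleGraph.mul_card_degree_ge_two_le_card_edgeFinset (by omega) ?_ ?_
  · rintro ⟨f, hinj, hdeg, hadj⟩
    obtain ⟨p, hp⟩ := exists_walk_support_eq_map f (t - 1) fun i hi => hadj i (by omega)
    rw [show t - 1 + 1 = t by omega] at hp
    refine hpath ⟨_, _, p, ?_, by simp [hp], ?_⟩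
    · rw [Walk.isPath_def, hp]
      refine List.Nodup.map_on (fun a ha b hb hab => hinj ?_ ?_ hab) List.nodup_range
      · exact List.mem_range.mp ha
      · exact List.mem_range.mp hb
    · intro w hw
      rw [hp] at hw
      obtain ⟨i, hi, rfl⟩ := List.mem_map.mp hw
      exact hdeg i (List.mem_range.mp hi)
  -- Closedness propagates along walks, so `S` contains every vertex and all degrees are two.
  · rintro ⟨S, ⟨v, hv⟩, -, hdeg, hclosed⟩
    refine hcycle (isCycleGraph_of_forall_degree_eq_two hconn fun w => hdeg w ?_)
    obtain ⟨p⟩ := hconn.preconnected v w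
    induction p with
    | nil => exact hv
    | cons h _ ih => exact ih (hclosed _ hv _ h)

end SimpleGraph

/-! ### Kernel families, pendant paths and rounding states -/

/-- A sub-isotropic family in the kernel of few linear forms, supported on many coordinates. -/
theorem exists_subisotropic_family_of_card_le {ι α : Type*} [Fintype ι] {F : Finset ι}
    (hF : F.Nonempty) (D : Finset α) (l : α → (ι → ℝ) →ₗ[ℝ] ℝ) {K : ℝ} (hK0 : 0 ≤ K)
    (hK : (F.card : ℝ) ≤ K * (F.card - D.card)) :
    ∃ (m : ℕ) (v : Fin m → ι → ℝ), (∃ k i, v k i ≠ 0) ∧ (∀ k i, v k i ≠ 0 → i ∈ F) ∧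
      (∀ k, ∀ u ∈ D, l u (v k) = 0) ∧
      ∀ a : ι → ℝ, ∑ k, (∑ i, a i * v k i) ^ 2 ≤ K * ∑ i, a i ^ 2 * ∑ k, v k i ^ 2 := by
  classical
  have : Nonempty F := hF.to_subtype
  let T : (F → ℝ) →ₗ[ℝ] (ι → ℝ) :=
    { toFun := fun w i => if h : i ∈ F then w ⟨i, h⟩ else 0
      map_add' := by intro x y; ext i; by_cases h : i ∈ F <;> simp [h]
      map_smul' := by intro c x; ext i; by_cases h : i ∈ F <;> simp [h] }
  have hT : ∀ w (i : F), T w i = w i := fun w i => dif_pos i.2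
  have hT0 : ∀ w i, i ∉ F → T w i = 0 := fun w i hi => dif_neg hi
  let L : (F → ℝ) →ₗ[ℝ] (D → ℝ) := LinearMap.pi fun u => (l u).comp T
  have hker : (F.card : ℝ) - D.card ≤ Module.finrank ℝ (LinearMap.ker L) := by
    have h1 := L.finrank_range_add_finrank_ker
    have h2 := Submodule.finrank_le (LinearMap.range L)
    simp only [Module.finrank_fintype_fun_eq_card, Fintype.card_coe] at h1 h2
    rw [sub_le_iff_le_add]
    exact_mod_cast (by omega : F.card ≤ Module.finrank ℝ (LinearMap.ker L) + D.card)
  obtain ⟨m, v, hv, ⟨k, i, hki⟩, hsub⟩ := exists_subisotropic_family (LinearMap.ker L) K (by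
    rw [Fintype.card_coe]
    exact hK.trans (mul_le_mul_of_nonneg_left hker hK0))
  refine ⟨m, fun k => T (v k), ⟨k, i, fun h => hki ((hT _ _).symm.trans h)⟩, fun k i h => ?_,
    fun k u hu => ?_, fun a => ?_⟩
  · by_contra hi
    exact h (hT0 _ _ hi)
  · exact congrFun (LinearMap.mem_ker.mp (hv k)) ⟨u, hu⟩
  · have hsum : ∀ g : ι → ℝ, (∀ i ∉ F, g i = 0) → ∑ i, g i = ∑ i : F, g i := by
      intro g hg
      rw [Finset.sum_coe_sort F g]
      exact (Finset.sum_subset (Finset.subset_univ F) fun i _ hi => hg i hi).symm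
    have e1 : ∀ k, ∑ i, a i * T (v k) i = ∑ i : F, a i * v k i := by
      intro k
      rw [hsum _ fun i hi => by simp [hT0 _ i hi]]
      simp_rw [hT]
    have e2 : ∑ i, a i ^ 2 * ∑ k, T (v k) i ^ 2 = ∑ i : F, a i ^ 2 * ∑ k, v k i ^ 2 := by
      rw [hsum _ fun i hi => by simp [hT0 _ i hi]]
      simp_rw [hT]
    simp_rw [e1, e2]
    exact hsub fun i => a i

namespace SimpleGraph

/-- Starting with the edge from `u` to `v`, one reaches a leaf of `H` by traversing at most `k`
further edges and passing only through vertices of degree `2`. -/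
inductive NearLeaf {V : Type*} (H : SimpleGraph V) : ℕ → V → V → Prop
  | leaf {k : ℕ} {u v : V} (h : ∀ w, H.Adj v w → w = u) : NearLeaf H k u v
  | step {k : ℕ} {u v w : V} (hwu : w ≠ u) (hvw : H.Adj v w)
      (h : ∀ w', H.Adj v w' → w' = u ∨ w' = w) (hk : NearLeaf H k v w) : NearLeaf H (k + 1) u v

variable {V : Type*} {H H' : SimpleGraph V}

/-- Removing an edge of the pendant path only creates a leaf earlier. This keeps exposed edges
recognizable throughout the rounding. -/
theorem NearLeaf.mono {k : ℕ} {u v : V} (h : H.NearLeaf k u v) (hle : H' ≤ H) :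
    H'.NearLeaf k u v := by
  induction h with
  | leaf h => exact .leaf fun w hw => h w (hle hw)
  | @step k u v w hwu hvw h hk ih =>
    by_cases hvw' : H'.Adj v w
    · exact .step hwu hvw' (fun w' hw' => h w' (hle hw')) ih
    · refine .leaf fun w' hw' => (h w' (hle hw')).resolve_right ?_
      rintro rfl
      exact hvw' hw'

/-- The continuation is forced at each degree-two vertex, so no leaf is within reach. Used to see
that edges in the middle of a long chain are unexposed. -/
theorem not_nearLeaf_of_chain {k : ℕ} (g : ℕ → V) (hadj : ∀ j ≤ k, H.Adj (g (j + 1)) (g (j + 2)))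
    (hne : ∀ j ≤ k, g (j + 2) ≠ g j)
    (hnb : ∀ j ≤ k, ∀ w, H.Adj (g (j + 1)) w → w = g j ∨ w = g (j + 2)) :
    ¬ H.NearLeaf k (g 0) (g 1) := by
  induction k generalizing g with
  | zero =>
    intro h
    cases h with
    | leaf h => exact hne 0 le_rfl (h _ (hadj 0 le_rfl))
  | succ k ih =>
    intro h
    cases h with
    | leaf h => exact hne 0 (by omega) (h _ (hadj 0 (by omega)))
    | @step _ _ _ w hwu hvw h hk =>
      obtain rfl := (hnb 0 (by omega) w hvw).resolve_left hwu
      exact ih (fun j => g (j + 1)) (fun j hj => hadj (j + 1) (by omega))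
        (fun j hj => hne (j + 1) (by omega)) (fun j hj => hnb (j + 1) (by omega)) hk

theorem nearLeaf_of_chain {k m : ℕ} (hm : m ≤ k) (g : ℕ → V)
    (hadj : ∀ j < m, H.Adj (g (j + 1)) (g (j + 2))) (hne : ∀ j < m, g (j + 2) ≠ g j)
    (hnb : ∀ j < m, ∀ w, H.Adj (g (j + 1)) w → w = g j ∨ w = g (j + 2))
    (hend : ∀ w, H.Adj (g (m + 1)) w → w = g m) : H.NearLeaf k (g 0) (g 1) := by
  induction m generalizing g k with
  | zero => exact .leaf hend
  | succ m ih =>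
    obtain ⟨k, rfl⟩ : ∃ k', k = k' + 1 := ⟨k - 1, by omega⟩
    exact .step (hne 0 (by omega)) (hadj 0 (by omega)) (hnb 0 (by omega))
      (ih (by omega) (fun j => g (j + 1)) (fun j hj => hadj (j + 1) (by omega))
        (fun j hj => hne (j + 1) (by omega)) (fun j hj => hnb (j + 1) (by omega)) hend)

end SimpleGraph

/-- The sum of the edge weights at a vertex. -/
noncomputable def vertexSum {V : Type*} [Fintype V] [DecidableEq V] (v : V) :
    (Sym2 V → ℝ) →ₗ[ℝ] ℝ :=
  ∑ e with v ∈ e, LinearMap.proj e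

theorem vertexSum_apply {V : Type*} [Fintype V] [DecidableEq V] (v : V) (x : Sym2 V → ℝ) :
    vertexSum v x = ∑ e with v ∈ e, x e := by
  simp [vertexSum]

/-- The graph of the edges whose weights are not integral yet. -/
def activeGraph {V : Type*} (x : Sym2 V → ℝ) : SimpleGraph V :=
  SimpleGraph.fromEdgeSet {e | x e ∈ Set.Ioo (0 : ℝ) 1}

/-- The states of the rounding procedure: weights `x` on the edges of `G`, and a set `T` of edges
that have already been exposed to a deletion. Exposed active edges lie on short pendant paths. -/
structure IsRoundingState {V : Type*} [Fintype V] [DecidableEq V] (G : SimpleGraph V) (t : ℕ)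
    (x : Sym2 V → ℝ) (T : Finset (Sym2 V)) : Prop where
  mem_Icc : ∀ e, x e ∈ Set.Icc (0 : ℝ) 1
  support : ∀ e, x e ≠ 0 → e ∈ G.edgeSet
  sum_le : ∀ v, vertexSum v x ≤ 1
  nearLeaf : ∀ u v, s(u, v) ∈ T → (activeGraph x).Adj u v →
    (activeGraph x).NearLeaf t u v ∨ (activeGraph x).NearLeaf t v u

section RoundingState

variable {V : Type*}

theorem activeGraph_adj {x : Sym2 V → ℝ} {u v : V} :
    (activeGraph x).Adj u v ↔ x s(u, v) ∈ Set.Ioo (0 : ℝ) 1 ∧ u ≠ v := by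
  simp [activeGraph]

theorem activeGraph_mono {x x' : Sym2 V → ℝ}
    (h : ∀ e, x' e ∈ Set.Ioo (0 : ℝ) 1 → x e ∈ Set.Ioo (0 : ℝ) 1) :
    activeGraph x' ≤ activeGraph x := by
  intro u v huv
  rw [activeGraph_adj] at huv ⊢
  exact ⟨h _ huv.1, huv.2⟩

variable [Fintype V] [DecidableEq V] {G : SimpleGraph V} {t : ℕ} {x : Sym2 V → ℝ}
  {T : Finset (Sym2 V)}

/-- A vertex whose constraint is not imposed has at most one active edge. If it has one, its other
edges have weight `0`, since a weight `1` would push the old sum above one; the new sum is then a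
single weight. -/
theorem IsRoundingState.of_span (hx : IsRoundingState G t x T) {m : ℕ} {v : Fin m → Sym2 V → ℝ}
    (hsum : ∀ u, (∀ k, vertexSum u (v k) = 0) ∨ ∀ e e', x e ∈ Set.Ioo (0 : ℝ) 1 →
      x e' ∈ Set.Ioo (0 : ℝ) 1 → u ∈ e → u ∈ e' → e = e')
    {x' : Sym2 V → ℝ} (hx' : ∀ e, x' e ∈ Set.Icc (0 : ℝ) 1)
    (hoff : ∀ e, x e ∉ Set.Ioo (0 : ℝ) 1 → x' e = x e)
    (hspan : x' - x ∈ Submodule.span ℝ (Set.range v)) : IsRoundingState G t x' T where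
  mem_Icc := hx'
  support e he := by
    by_cases h : x e ∈ Set.Ioo (0 : ℝ) 1
    · exact hx.support e h.1.ne'
    · exact hx.support e (hoff e h ▸ he)
  sum_le u := by
    rcases hsum u with h | h
    · have h0 : vertexSum u (x' - x) = 0 := by
        have hle : Submodule.span ℝ (Set.range v) ≤ LinearMap.ker (vertexSum u) :=
          Submodule.span_le.mpr (by rintro _ ⟨k, rfl⟩; exact h k)
        exact hle hspan
      rw [map_sub, sub_eq_zero] at h0
      rw [h0]; exact hx.sum_le u
    · by_cases hex : ∃ e, u ∈ e ∧ x e ∈ Set.Ioo (0 : ℝ) 1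
      · obtain ⟨e, hue, he⟩ := hex
        have hzero : ∀ e', u ∈ e' → e' ≠ e → x' e' = 0 := by
          intro e' hue' hne
          have hna : x e' ∉ Set.Ioo (0 : ℝ) 1 := fun h' => hne (h e' e h' he hue' hue)
          rw [hoff e' hna]
          by_contra h0
          have hpos : 0 < x e' := lt_of_le_of_ne (hx.mem_Icc e').1 (Ne.symm h0)
          have h1 : 1 ≤ x e' := by
            by_contra hlt; exact hna ⟨hpos, not_le.mp hlt⟩
          have hs := hx.sum_le u
          rw [vertexSum_apply] at hs
          have hpair : ∑ a ∈ {e', e}, x a ≤ ∑ a with u ∈ a, x a := by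
            refine Finset.sum_le_sum_of_subset_of_nonneg ?_ fun a _ _ => (hx.mem_Icc a).1
            intro a ha
            rcases Finset.mem_insert.mp ha with rfl | ha
            · simpa using hue'
            · rw [Finset.mem_singleton.mp ha]; simpa using hue
          rw [Finset.sum_pair hne] at hpair
          linarith [he.1]
        rw [vertexSum_apply, Finset.sum_eq_single e]
        · exact (hx' e).2
        · intro e' he' hne
          exact hzero e' (Finset.mem_filter.mp he').2 hne
        · simp [hue]
      · push Not at hex
        have : vertexSum u x' = vertexSum u x := by
          rw [vertexSum_apply, vertexSum_apply]
          exact Finset.sum_congr rfl fun e he => hoff e (hex e (Finset.mem_filter.mp he).2)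
        rw [this]; exact hx.sum_le u
  nearLeaf u w hT hadj := by
    have hmono : activeGraph x' ≤ activeGraph x := activeGraph_mono fun e he => by
      by_contra h; rw [hoff e h] at he; exact h he
    exact (hx.nearLeaf u w hT (hmono hadj)).imp (fun h => h.mono hmono) fun h => h.mono hmono

/-- `z` enumerates (at least) the indicator vectors of the matchings of `G`. -/
def CoversMatchings {Ω : Type*} (G : SimpleGraph V) (z : Ω → Sym2 V → ℝ) : Prop :=
  ∀ m : Finset (Sym2 V), (∀ e ∈ m, e ∈ G.edgeSet) →
    (∀ v, ∀ e ∈ m, ∀ e' ∈ m, v ∈ e → v ∈ e' → e = e') →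
    ∃ ω, z ω = fun e => if e ∈ m then 1 else 0

variable {Ω : Type*} [Fintype Ω] {z : Ω → Sym2 V → ℝ} {K : ℝ}

theorem IsRoundingState.rounds_of_integral (hx : IsRoundingState G t x T) (hz : CoversMatchings G z)
    (hK : 1 ≤ K) {c : Sym2 V → ℝ} (hc : ∀ e, c e ∈ Set.Icc (0 : ℝ) 1)
    (hint : ∀ e, x e ∉ Set.Ioo (0 : ℝ) 1) : RoundsUpTo (7 * K) z (fun e => c e * x e) 0 := by
  have h01 : ∀ e, x e ≠ 0 → x e = 1 := by
    intro e he
    have hpos : 0 < x e := lt_of_le_of_ne (hx.mem_Icc e).1 (Ne.symm he)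
    by_contra h1
    exact hint e ⟨hpos, lt_of_le_of_ne (hx.mem_Icc e).2 h1⟩
  refine RoundsUpTo.of_support_subset hK (fun e => ⟨mul_nonneg (hc e).1 (hx.mem_Icc e).1,
    mul_le_one₀ (hc e).2 (hx.mem_Icc e).1 (hx.mem_Icc e).2⟩)
    (Finset.univ.filter fun e => x e ≠ 0) (fun e he => ?_) fun m hm => hz m ?_ ?_
  · simpa using right_ne_zero_of_mul he
  · intro e he
    exact hx.support e (by simpa using hm he)
  · intro u e he e' he' hue hue'
    by_contra hne
    have hs := hx.sum_le u
    rw [vertexSum_apply] at hs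
    have hpair : ∑ a ∈ {e, e'}, x a ≤ ∑ a with u ∈ a, x a := by
      refine Finset.sum_le_sum_of_subset_of_nonneg ?_ fun a _ _ => (hx.mem_Icc a).1
      intro a ha
      rcases Finset.mem_insert.mp ha with rfl | ha
      · simpa using hue
      · rw [Finset.mem_singleton.mp ha]; simpa using hue'
    rw [Finset.sum_pair hne, h01 e (by simpa using hm he), h01 e' (by simpa using hm he')] at hpair
    linarith

/-- Deleting one edge of a chain of `t` unexposed edges, all of which become exposed. -/
theorem IsRoundingState.delete_from_chain (hx : IsRoundingState G t x T) {f : ℕ → V}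
    (hadj : ∀ i < t, (activeGraph x).Adj (f i) (f (i + 1)))
    (hinj : Set.InjOn f (Set.Iic t))
    (hnb : ∀ i, i + 1 < t → ∀ w, (activeGraph x).Adj (f (i + 1)) w → w = f i ∨ w = f (i + 2))
    {j : ℕ} (hj : j < t) :
    IsRoundingState G t (Function.update x s(f j, f (j + 1)) 0)
      (T ∪ (Finset.range t).image fun i => s(f i, f (i + 1))) where
  mem_Icc e := by
    by_cases h : e = s(f j, f (j + 1))
    · subst h; simp
    · simpa [h] using hx.mem_Icc e
  support e he := by
    by_cases h : e = s(f j, f (j + 1))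
    · subst h; simp at he
    · exact hx.support e (by simpa [h] using he)
  sum_le v := by
    refine le_trans ?_ (hx.sum_le v)
    rw [vertexSum_apply, vertexSum_apply]
    refine Finset.sum_le_sum fun e _ => ?_
    by_cases h : e = s(f j, f (j + 1))
    · subst h; simpa using (hx.mem_Icc _).1
    · simp [h]
  nearLeaf u v huv hadj' := by
    set x' := Function.update x s(f j, f (j + 1)) 0 with hx'
    have hadj_iff : ∀ a b, (activeGraph x').Adj a b ↔
        (activeGraph x).Adj a b ∧ s(a, b) ≠ s(f j, f (j + 1)) := by
      intro a b
      rw [activeGraph_adj, activeGraph_adj]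
      by_cases h : s(a, b) = s(f j, f (j + 1))
      · simp [hx', h]
      · simp [hx', h]
    have hmono : activeGraph x' ≤ activeGraph x := fun a b h => ((hadj_iff a b).mp h).1
    rcases Finset.mem_union.mp huv with hT | himg
    · exact (hx.nearLeaf u v hT (hmono hadj')).imp (fun h => h.mono hmono) fun h => h.mono hmono
    obtain ⟨i, hi, hiuv⟩ := Finset.mem_image.mp himg
    have hi := Finset.mem_range.mp hi
    have hij : i ≠ j := by
      rintro rfl
      exact ((hadj_iff u v).mp hadj').2 hiuv.symm
    suffices h : (activeGraph x').NearLeaf t (f i) (f (i + 1)) ∨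
        (activeGraph x').NearLeaf t (f (i + 1)) (f i) by
      rcases Sym2.eq_iff.mp hiuv with ⟨rfl, rfl⟩ | ⟨rfl, rfl⟩
      · exact h
      · exact h.symm
    have hedge : ∀ a < t, a ≠ j → (activeGraph x').Adj (f a) (f (a + 1)) := by
      intro a ha haj
      refine (hadj_iff _ _).mpr ⟨hadj a ha, fun h => ?_⟩
      rcases Sym2.eq_iff.mp h with ⟨h1, -⟩ | ⟨h1, h2⟩
      · exact haj (hinj (Set.mem_Iic.mpr ha.le) (Set.mem_Iic.mpr hj.le) h1)
      · have h3 := hinj (Set.mem_Iic.mpr ha.le) (Set.mem_Iic.mpr hj) h1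
        have h4 := hinj (Set.mem_Iic.mpr ha) (Set.mem_Iic.mpr hj.le) h2
        omega
    have hne : ∀ i, i + 1 < t → f (i + 2) ≠ f i := fun i hi h => by
      have := hinj (Set.mem_Iic.mpr (by omega)) (Set.mem_Iic.mpr (by omega)) h
      omega
    have hdel : ∀ a b, s(a, b) = s(f j, f (j + 1)) → ¬ (activeGraph x').Adj a b :=
      fun a b h h' => ((hadj_iff a b).mp h').2 h
    -- The deletion makes the two ends of the missing edge leaves: edges before it reach `f j` going
    -- forwards, edges after it reach `f (j + 1)` going backwards.
    rcases lt_or_gt_of_ne hij with hlt | hgt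
    · left
      obtain ⟨m, rfl⟩ : ∃ m, j = i + m + 1 := ⟨j - i - 1, by omega⟩
      refine SimpleGraph.nearLeaf_of_chain (m := m) (by omega) (fun l => f (i + l))
        (fun l hl => hedge (i + l + 1) (by omega) (by omega)) (fun l hl => hne (i + l) (by omega))
        (fun l hl w hw => hnb (i + l) (by omega) w (hmono hw)) fun w hw => ?_
      refine (hnb (i + m) (by omega) w (hmono hw)).resolve_right ?_
      rintro rfl
      exact hdel _ _ rfl hw
    · right
      obtain ⟨m, rfl⟩ : ∃ m, i = j + m + 1 := ⟨i - j - 1, by omega⟩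
      have hsub : ∀ l ≤ m, ∃ b, j ≤ b ∧ b + l = j + m ∧ j + m + 1 + 1 - l = b + 2 ∧
          j + m + 1 + 1 - (l + 1) = b + 1 ∧ j + m + 1 + 1 - (l + 2) = b :=
        fun l hl => ⟨j + m - l, by omega, by omega, by omega, by omega, by omega⟩
      refine SimpleGraph.nearLeaf_of_chain (m := m) (by omega) (fun l => f (j + m + 1 + 1 - l))
        (fun l hl => ?_) (fun l hl => ?_) (fun l hl w hw => ?_) fun w hw => ?_
      · obtain ⟨b, hb, hbl, e1, e2, e3⟩ := hsub l hl.le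
        simp only [e2, e3]
        exact (hedge b (by omega) (by omega)).symm
      · obtain ⟨b, hb, hbl, e1, e2, e3⟩ := hsub l hl.le
        simp only [e1, e3]
        exact (hne b (by omega)).symm
      · obtain ⟨b, hb, hbl, e1, e2, e3⟩ := hsub l hl.le
        simp only [e1, e2, e3] at hw ⊢
        exact (hnb b (by omega) w (hmono hw)).symm
      · obtain ⟨b, hb, hbl, e1, e2, e3⟩ := hsub m le_rfl
        obtain rfl : b = j := by omega
        simp only [e1, e2] at hw ⊢
        refine (hnb b (by omega) w (hmono hw)).resolve_left ?_
        rintro rfl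
        exact hdel _ _ Sym2.eq_swap hw

end RoundingState

/-! ### Rounding every state by induction -/

section Rounds

variable {V : Type*} [Fintype V] [DecidableEq V] {G : SimpleGraph V} {t : ℕ} {x : Sym2 V → ℝ}
  {T : Finset (Sym2 V)} {Ω : Type*} [Fintype Ω] {z : Ω → Sym2 V → ℝ} {K : ℝ}

theorem IsRoundingState.rounds_of_family (hx : IsRoundingState G t x T) (hK : 1 ≤ K)
    {c : Sym2 V → ℝ} (hc : ∀ e, c e ∈ Set.Icc (0 : ℝ) 1) {m : ℕ} {v : Fin m → Sym2 V → ℝ}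
    (hv0 : ∃ k i, v k i ≠ 0) (hvsupp : ∀ k i, v k i ≠ 0 → x i ∈ Set.Ioo (0 : ℝ) 1)
    (hsub : ∀ a : Sym2 V → ℝ,
      ∑ k, (∑ i, a i * v k i) ^ 2 ≤ K * ∑ i, a i ^ 2 * ∑ k, v k i ^ 2)
    (hsum : ∀ u, (∀ k, vertexSum u (v k) = 0) ∨ ∀ e e', x e ∈ Set.Ioo (0 : ℝ) 1 →
      x e' ∈ Set.Ioo (0 : ℝ) 1 → u ∈ e → u ∈ e' → e = e')
    (hind : ∀ x', IsRoundingState G t x' T →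
      {e | x' e ∈ Set.Ioo (0 : ℝ) 1} ⊂ {e | x e ∈ Set.Ioo (0 : ℝ) 1} →
      RoundsUpTo (7 * K) z (fun e => c e * x' e) 0) :
    RoundsUpTo (7 * K) z (fun e => c e * x e) 0 := by
  refine RoundsUpTo.of_walk_to_boundary hK hc hx.mem_Icc hv0 hvsupp hsub
    fun x' hx' hoff hspan ⟨e, he, he'⟩ => hind x' (hx.of_span hsum hx' hoff hspan)
      ⟨fun e' h' => ?_, fun h => he' (h he)⟩
  by_contra h
  have h2 : x' e' ∈ Set.Ioo (0 : ℝ) 1 := h'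
  rw [hoff e' h] at h2
  exact h h2

/-- The factor `(t-1)/t` held back on unexposed edges cancels the growth `t/(t-1)`: surviving chain
edges keep their `x` and pass to the factor `κ`. -/
theorem IsRoundingState.rounds_of_chain (hx : IsRoundingState G t x T) (ht : 2 ≤ t) (hK : 2 ≤ K)
    {κ : ℝ} (hκ : κ ∈ Set.Icc (0 : ℝ) 1) {f : ℕ → V} (hinj : Set.InjOn f (Set.Iic t))
    (hadj : ∀ i < t, (activeGraph x).Adj (f i) (f (i + 1)))
    (hnb : ∀ i, i + 1 < t → ∀ w, (activeGraph x).Adj (f (i + 1)) w → w = f i ∨ w = f (i + 2))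
    (hnew : ∀ i < t, s(f i, f (i + 1)) ∉ T)
    (hind : ∀ x' T', IsRoundingState G t x' T' →
      {e | x' e ∈ Set.Ioo (0 : ℝ) 1} ⊆ {e | x e ∈ Set.Ioo (0 : ℝ) 1} → T ⊂ T' →
      RoundsUpTo (7 * K) z (fun e => (if e ∈ T' then κ else κ * ((t - 1) / t)) * x' e) 0) :
    RoundsUpTo (7 * K) z (fun e => (if e ∈ T then κ else κ * ((t - 1) / t)) * x e) 0 := by
  have htR : (2 : ℝ) ≤ t := by exact_mod_cast ht
  have hr0 : 0 ≤ ((t : ℝ) - 1) / t := div_nonneg (by linarith) (by linarith)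
  have hr1 : ((t : ℝ) - 1) / t ≤ 1 := by rw [div_le_one (by linarith)]; linarith
  have ht1 : (t : ℝ) - 1 ≠ 0 := by linarith
  have ht0 : (t : ℝ) ≠ 0 := by linarith
  have hedge : ∀ a < t, ∀ b < t, s(f a, f (a + 1)) = s(f b, f (b + 1)) → a = b := by
    intro a ha b hb h
    rcases Sym2.eq_iff.mp h with ⟨h1, -⟩ | ⟨h1, h2⟩
    · exact hinj (Set.mem_Iic.mpr ha.le) (Set.mem_Iic.mpr hb.le) h1
    · have h3 := hinj (Set.mem_Iic.mpr ha.le) (Set.mem_Iic.mpr hb) h1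
      have h4 := hinj (Set.mem_Iic.mpr ha) (Set.mem_Iic.mpr hb.le) h2
      omega
  let S := (Finset.range t).image fun i => s(f i, f (i + 1))
  have hScard : S.card = t := by
    rw [Finset.card_image_of_injOn, Finset.card_range]
    intro a ha b hb h
    exact hedge a (by simpa using ha) b (by simpa using hb) h
  have hST : ∀ e ∈ S, e ∉ T := by
    intro e he
    obtain ⟨i, hi, rfl⟩ := Finset.mem_image.mp he
    exact hnew i (Finset.mem_range.mp hi)
  refine RoundsUpTo.of_delete_one hK (fun e => ?_) S t (by exact_mod_cast hScard) htR
    (fun e he => ?_) fun e he => ?_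
  · have hc : (if e ∈ T then κ else κ * (((t : ℝ) - 1) / t)) ∈ Set.Icc (0 : ℝ) 1 := by
      split_ifs
      · exact hκ
      · exact ⟨mul_nonneg hκ.1 hr0, mul_le_one₀ hκ.2 hr0 hr1⟩
    exact ⟨mul_nonneg hc.1 (hx.mem_Icc e).1, mul_le_one₀ hc.2 (hx.mem_Icc e).1 (hx.mem_Icc e).2⟩
  · rw [if_neg (hST e he)]
    have : κ * (((t : ℝ) - 1) / t) * x e * (t / (t - 1)) = κ * x e := by field_simp
    rw [this]
    exact mul_le_one₀ hκ.2 (hx.mem_Icc e).1 (hx.mem_Icc e).2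
  · obtain ⟨j, hj, rfl⟩ := Finset.mem_image.mp he
    have hj := Finset.mem_range.mp hj
    have hst := hx.delete_from_chain hadj hinj hnb hj
    have h := hind _ _ hst (fun e' he' => ?_) ⟨Finset.subset_union_left, fun hsub =>
      hnew j hj (hsub (Finset.mem_union_right _ he))⟩
    · convert h using 1
      ext e'
      by_cases heS : e' ∈ S
      · have h1 : e' ∈ T ∪ S := Finset.mem_union_right _ heS
        rw [if_pos heS, if_neg (hST e' heS)]
        simp only [S] at h1
        rw [if_pos h1]
        by_cases hej : e' = s(f j, f (j + 1))
        · simp [hej]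
        · rw [if_neg hej, Function.update_of_ne hej]; field_simp
      · have hej : e' ≠ s(f j, f (j + 1)) := fun h => heS (h ▸ he)
        have h1 : e' ∈ T ∪ S ↔ e' ∈ T := by simp [heS]
        simp only [S] at h1
        rw [if_neg heS, Function.update_of_ne hej]
        simp only [h1]
    · by_cases hej : e' = s(f j, f (j + 1))
      · subst hej; simp at he'
      · simpa [hej] using he'

theorem IsRoundingState.edgeSet_activeGraph (hx : IsRoundingState G t x T) :
    (activeGraph x).edgeSet = {e | x e ∈ Set.Ioo (0 : ℝ) 1} := by
  rw [activeGraph, SimpleGraph.edgeSet_fromEdgeSet]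
  refine sdiff_eq_left.mpr (Set.disjoint_left.mpr fun e he hd => ?_)
  exact SimpleGraph.not_isDiag_of_mem_edgeSet G (hx.support e he.1.ne') hd

open Classical in
theorem IsRoundingState.card_active_eq_degree (hx : IsRoundingState G t x T) (u : V) :
    (Finset.univ.filter fun e => x e ∈ Set.Ioo (0 : ℝ) 1 ∧ u ∈ e).card =
      (activeGraph x).degree u := by
  rw [← SimpleGraph.card_incidenceFinset_eq_degree]
  congr 1
  ext e
  rw [SimpleGraph.mem_incidenceFinset, SimpleGraph.incidenceSet, hx.edgeSet_activeGraph]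
  simp

open Classical in
theorem IsRoundingState.eq_of_degree_lt_two (hx : IsRoundingState G t x T) {u : V}
    (hu : (activeGraph x).degree u < 2) {e e' : Sym2 V} (he : x e ∈ Set.Ioo (0 : ℝ) 1)
    (he' : x e' ∈ Set.Ioo (0 : ℝ) 1) (hue : u ∈ e) (hue' : u ∈ e') : e = e' := by
  rw [← hx.card_active_eq_degree] at hu
  exact Finset.card_le_one.mp (Nat.lt_succ_iff.mp hu) e
    (Finset.mem_filter.mpr ⟨Finset.mem_univ _, he, hue⟩) e'
    (Finset.mem_filter.mpr ⟨Finset.mem_univ _, he', hue'⟩)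

open Classical in
-- Constraints are imposed only at vertices with at least two active edges; elsewhere the second
-- alternative is automatic.
theorem IsRoundingState.exists_family_of_card_le (hx : IsRoundingState G t x T) (hK : 0 ≤ K)
    (hact : ∃ e, x e ∈ Set.Ioo (0 : ℝ) 1)
    (hcard : ((activeGraph x).edgeFinset.card : ℝ) ≤ K * ((activeGraph x).edgeFinset.card -
      (Finset.univ.filter fun u => 2 ≤ (activeGraph x).degree u).card)) :
    ∃ (m : ℕ) (v : Fin m → Sym2 V → ℝ), (∃ k i, v k i ≠ 0) ∧
      (∀ k i, v k i ≠ 0 → x i ∈ Set.Ioo (0 : ℝ) 1) ∧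
      (∀ u, (∀ k, vertexSum u (v k) = 0) ∨ ∀ e e', x e ∈ Set.Ioo (0 : ℝ) 1 →
        x e' ∈ Set.Ioo (0 : ℝ) 1 → u ∈ e → u ∈ e' → e = e') ∧
      ∀ a : Sym2 V → ℝ, ∑ k, (∑ i, a i * v k i) ^ 2 ≤ K * ∑ i, a i ^ 2 * ∑ k, v k i ^ 2 := by
  have hmem : ∀ e, e ∈ (activeGraph x).edgeFinset ↔ x e ∈ Set.Ioo (0 : ℝ) 1 := by
    intro e; rw [SimpleGraph.mem_edgeFinset, hx.edgeSet_activeGraph]; rfl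
  obtain ⟨e, he⟩ := hact
  obtain ⟨m, v, h0, hsupp, hsum, hsub⟩ := exists_subisotropic_family_of_card_le
    (F := (activeGraph x).edgeFinset) ⟨e, (hmem e).mpr he⟩
    (Finset.univ.filter fun u => 2 ≤ (activeGraph x).degree u) vertexSum hK hcard
  refine ⟨m, v, h0, fun k i h => (hmem i).mp (hsupp k i h), fun u => ?_, hsub⟩
  by_cases hu : 2 ≤ (activeGraph x).degree u
  · exact Or.inl fun k => hsum k u (Finset.mem_filter.mpr ⟨Finset.mem_univ _, hu⟩)
  · exact Or.inr fun e e' h h' hue hue' => hx.eq_of_degree_lt_two (not_le.mp hu) h h' hue hue'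

open Classical in
-- On a union of active cycles there are as many edges as vertices, but the constraint at one vertex
-- `u₀` may be dropped. This leaves dimension at least one, which suffices because `K` is at least
-- the number of edges.
theorem IsRoundingState.exists_family_of_closed (hx : IsRoundingState G t x T)
    (hG : G.IsBipartite) {S : Finset V} (hS : S.Nonempty)
    (hdeg : ∀ v ∈ S, (activeGraph x).degree v = 2)
    (hclosed : ∀ v ∈ S, ∀ w, (activeGraph x).Adj v w → w ∈ S) (hK : (S.card : ℝ) ≤ K) :
    ∃ (m : ℕ) (v : Fin m → Sym2 V → ℝ), (∃ k i, v k i ≠ 0) ∧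
      (∀ k i, v k i ≠ 0 → x i ∈ Set.Ioo (0 : ℝ) 1) ∧ (∀ u k, vertexSum u (v k) = 0) ∧
      ∀ a : Sym2 V → ℝ, ∑ k, (∑ i, a i * v k i) ^ 2 ≤ K * ∑ i, a i ^ 2 * ∑ k, v k i ^ 2 := by
  obtain ⟨u₀, hu₀⟩ := hS
  let F := Finset.univ.filter fun e => x e ∈ Set.Ioo (0 : ℝ) 1 ∧ ∃ u ∈ S, u ∈ e
  have hF : ∀ e ∈ F, ∃ a b, e = s(a, b) ∧ a ≠ b ∧ G.Adj a b ∧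
      ∀ u, u ∈ S ∧ u ∈ e ↔ u = a ∨ u = b := by
    intro e he
    obtain ⟨hact, u, hu, hue⟩ := (Finset.mem_filter.mp he).2
    obtain ⟨b, rfl⟩ := hue
    have hadjG : G.Adj u b := hx.support _ hact.1.ne'
    have hb : b ∈ S := hclosed u hu b (activeGraph_adj.mpr ⟨hact, hadjG.ne⟩)
    refine ⟨u, b, rfl, hadjG.ne, hadjG, fun w => ?_⟩
    rw [Sym2.mem_iff]
    constructor
    · exact fun h => h.2
    · rintro (rfl | rfl)
      · exact ⟨hu, Or.inl rfl⟩
      · exact ⟨hb, Or.inr rfl⟩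
  have hFcard : F.card = S.card := by
    have h1 : ∑ u ∈ S, ∑ e ∈ F, (if u ∈ e then 1 else 0) = 2 * S.card := by
      rw [Finset.sum_congr rfl (g := fun _ => 2), Finset.sum_const, smul_eq_mul, mul_comm]
      intro u hu
      rw [← hdeg u hu, ← hx.card_active_eq_degree, ← Finset.card_filter]
      congr 1
      ext e
      simp only [F, Finset.mem_filter, Finset.mem_univ, true_and]
      constructor
      · exact fun h => ⟨h.1.1, h.2⟩
      · exact fun h => ⟨⟨h.1, u, hu, h.2⟩, h.2⟩
    have h2 : ∑ e ∈ F, ∑ u ∈ S, (if u ∈ e then 1 else 0) = 2 * F.card := by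
      rw [Finset.sum_congr rfl (g := fun _ => 2), Finset.sum_const, smul_eq_mul, mul_comm]
      intro e he
      obtain ⟨a, b, -, hab, -, hmem⟩ := hF e he
      rw [← Finset.card_filter, ← Finset.card_pair hab]
      congr 1
      ext u
      simp [hmem u]
    rw [Finset.sum_comm, h2] at h1
    omega
  have hFne : F.Nonempty := by
    rw [← Finset.card_pos, hFcard]
    exact Finset.card_pos.mpr ⟨u₀, hu₀⟩
  have hS1 : 1 ≤ S.card := Finset.card_pos.mpr ⟨u₀, hu₀⟩
  obtain ⟨m, v, h0, hsupp, hsum, hsub⟩ := exists_subisotropic_family_of_card_le hFne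
    (S.erase u₀) vertexSum ((Nat.cast_nonneg S.card).trans hK) (by
      rw [hFcard, Finset.card_erase_of_mem hu₀, Nat.cast_sub hS1]
      simpa using hK)
  refine ⟨m, v, h0, fun k i h => (Finset.mem_filter.mp (hsupp k i h)).2.1, fun u k => ?_, hsub⟩
  by_cases hu : u ∈ S
  · by_cases huu : u = u₀
    · subst huu
      -- With signs given by the colour classes, the vertex sums over `S` cancel edge by edge, so
      -- the constraint at `u₀` follows from the others.
      obtain ⟨C⟩ := hG
      let sgn : V → ℝ := fun w => if C w = 0 then 1 else -1
      have hsgn : ∀ a b, G.Adj a b → sgn a + sgn b = 0 := by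
        intro a b hab
        have := C.valid hab
        simp only [sgn]
        split_ifs with h1 h2 h2
        · exact absurd (h1.trans h2.symm) this
        · norm_num
        · norm_num
        · exact absurd (by omega) this
      have hz : ∑ w ∈ S, sgn w * vertexSum w (v k) = 0 := by
        simp_rw [vertexSum_apply, Finset.sum_filter, Finset.mul_sum]
        rw [Finset.sum_comm]
        refine Finset.sum_eq_zero fun e _ => ?_
        by_cases he : v k e = 0
        · simp [he]
        · obtain ⟨a, b, rfl, hab, hadj, hmem⟩ := hF e (hsupp k e he)
          have : ∑ w ∈ S, sgn w * (if w ∈ s(a, b) then v k s(a, b) else 0) =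
              ∑ w ∈ {a, b}, sgn w * v k s(a, b) := by
            simp_rw [mul_ite, mul_zero]
            rw [← Finset.sum_filter]
            congr 1
            ext w
            rw [Finset.mem_filter, hmem w]; simp
          rw [this, Finset.sum_pair hab, ← add_mul, hsgn a b hadj, zero_mul]
      rw [Finset.sum_eq_single_of_mem u hu fun w hw hwu => by
        rw [hsum k w (Finset.mem_erase.mpr ⟨hwu, hw⟩), mul_zero]] at hz
      refine (mul_eq_zero.mp hz).resolve_left ?_
      simp only [sgn]; split_ifs <;> norm_num
    · exact hsum k u (Finset.mem_erase.mpr ⟨huu, hu⟩)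
  · rw [vertexSum_apply]
    refine Finset.sum_eq_zero fun e he => ?_
    by_contra hne
    obtain ⟨a, b, rfl, -, -, hmem⟩ := hF e (hsupp k e hne)
    have hu' := Sym2.mem_iff.mp (Finset.mem_filter.mp he).2
    exact hu ((hmem u).mpr hu').1

end Rounds

theorem SimpleGraph.adj_of_degree_eq_two {V : Type*} [Fintype V] {H : SimpleGraph V}
    [DecidableRel H.Adj] {u a b : V} (hu : H.degree u = 2) (ha : H.Adj u a) (hb : H.Adj u b)
    (hab : a ≠ b) {w : V} (hw : H.Adj u w) : w = a ∨ w = b := by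
  classical
  have hN : ({a, b} : Finset V) = H.neighborFinset u := by
    refine Finset.eq_of_subset_of_card_le ?_ ?_
    · intro c hc
      rw [SimpleGraph.mem_neighborFinset]
      rcases Finset.mem_insert.mp hc with rfl | hc
      · exact ha
      · rw [Finset.mem_singleton.mp hc]; exact hb
    · rw [SimpleGraph.card_neighborFinset_eq_degree, hu, Finset.card_pair hab]
  rw [← SimpleGraph.mem_neighborFinset, ← hN] at hw
  simpa using hw

/-- Induction on the number of active edges plus the number of unexposed pairs: walks decrease the
first, deletions increase neither and decrease the second. The constant `K = 4(3t+3) + 1` makes `m ≤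
K (m - D)` equivalent to the edge bound for chains of `3t + 3` vertices. -/
theorem IsRoundingState.rounds {V Ω : Type*} [Fintype V] [DecidableEq V] [Fintype Ω]
    {G : SimpleGraph V} (hG : G.IsBipartite) {z : Ω → Sym2 V → ℝ} (hz : CoversMatchings G z)
    {t : ℕ} (ht : 2 ≤ t) {κ : ℝ} (hκ : κ ∈ Set.Icc (0 : ℝ) 1) {x : Sym2 V → ℝ}
    {T : Finset (Sym2 V)} (hx : IsRoundingState G t x T) :
    RoundsUpTo (7 * (4 * (3 * t + 3) + 1)) z
      (fun e => (if e ∈ T then κ else κ * ((t - 1) / t)) * x e) 0 := by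
  classical
  have htR : (2 : ℝ) ≤ t := by exact_mod_cast ht
  have hK2 : (2 : ℝ) ≤ 4 * (3 * t + 3) + 1 := by linarith
  have hK1 : (1 : ℝ) ≤ 4 * (3 * t + 3) + 1 := by linarith
  induction hn : (Finset.univ.filter fun e => x e ∈ Set.Ioo (0 : ℝ) 1).card +
      (Finset.univ \ T).card using Nat.strong_induction_on generalizing x T with
  | _ n ih =>
    have hr0 : 0 ≤ ((t : ℝ) - 1) / t := div_nonneg (by linarith) (by linarith)
    have hr1 : ((t : ℝ) - 1) / t ≤ 1 := by rw [div_le_one (by linarith)]; linarith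
    have hc : ∀ e, (if e ∈ T then κ else κ * (((t : ℝ) - 1) / t)) ∈ Set.Icc (0 : ℝ) 1 := by
      intro e
      split_ifs
      · exact hκ
      · exact ⟨mul_nonneg hκ.1 hr0, mul_le_one₀ hκ.2 hr0 hr1⟩
    by_cases hact : ∃ e, x e ∈ Set.Ioo (0 : ℝ) 1
    swap
    · exact hx.rounds_of_integral hz hK1 hc fun e he => hact ⟨e, he⟩
    have hind : ∀ x', IsRoundingState G t x' T →
        {e | x' e ∈ Set.Ioo (0 : ℝ) 1} ⊂ {e | x e ∈ Set.Ioo (0 : ℝ) 1} →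
        RoundsUpTo (7 * (4 * (3 * t + 3) + 1)) z
          (fun e => (if e ∈ T then κ else κ * ((t - 1) / t)) * x' e) 0 := by
      intro x' hx' hss
      refine ih _ ?_ hx' rfl
      rw [← hn]
      refine Nat.add_lt_add_right (Finset.card_lt_card ?_) _
      rw [← Finset.coe_ssubset]
      simpa using hss
    by_cases hchain : ∃ f : ℕ → V, Set.InjOn f (Set.Iio (3 * t + 3)) ∧
        (∀ i < 3 * t + 3, (activeGraph x).degree (f i) = 2) ∧
        ∀ i, i + 1 < 3 * t + 3 → (activeGraph x).Adj (f i) (f (i + 1))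
    · obtain ⟨f, hinj, hdeg, hadj⟩ := hchain
      have hne : ∀ i, i + 2 < 3 * t + 3 → f (i + 2) ≠ f i := fun i hi h => by
        have := hinj (Set.mem_Iio.mpr hi) (Set.mem_Iio.mpr (by omega)) h
        omega
      have hnb : ∀ i, i + 2 < 3 * t + 3 → ∀ w, (activeGraph x).Adj (f (i + 1)) w →
          w = f i ∨ w = f (i + 2) := fun i hi w hw =>
        SimpleGraph.adj_of_degree_eq_two (hdeg (i + 1) (by omega)) (hadj i (by omega)).symm
          (hadj (i + 1) hi) (hne i hi).symm hw
      -- The middle block of `t + 1` vertices has `t + 1` chain vertices on either side, so none of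
      -- its `t` edges is within `t` steps of a leaf, and none is exposed.
      refine hx.rounds_of_chain ht hK2 hκ (f := fun i => f (t + 1 + i)) ?_
        (fun i hi => hadj (t + 1 + i) (by omega))
        (fun i hi w hw => hnb (t + 1 + i) (by omega) w hw) (fun i hi hT => ?_)
        fun x' T' hx' hsub hTT => ?_
      · intro a ha b hb h
        have ha := Set.mem_Iic.mp ha
        have hb := Set.mem_Iic.mp hb
        have := hinj (Set.mem_Iio.mpr (by omega)) (Set.mem_Iio.mpr (by omega)) h
        omega
      · rcases hx.nearLeaf _ _ hT (hadj (t + 1 + i) (by omega)) with h | h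
        · exact SimpleGraph.not_nearLeaf_of_chain (fun l => f (t + 1 + i + l))
            (fun l hl => hadj (t + 1 + i + l + 1) (by omega))
            (fun l hl => hne (t + 1 + i + l) (by omega))
            (fun l hl w hw => hnb (t + 1 + i + l) (by omega) w hw) h
        · have hsub : ∀ l ≤ t, ∃ b, b + l = t + i ∧ t + 1 + i + 1 - l = b + 2 ∧
              t + 1 + i + 1 - (l + 1) = b + 1 ∧ t + 1 + i + 1 - (l + 2) = b :=
            fun l hl => ⟨t + i - l, by omega, by omega, by omega, by omega⟩
          refine SimpleGraph.not_nearLeaf_of_chain (fun l => f (t + 1 + i + 1 - l))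
            (fun l hl => ?_) (fun l hl => ?_) (fun l hl w hw => ?_) h
          · obtain ⟨b, hb, e1, e2, e3⟩ := hsub l hl
            simp only [e2, e3]
            exact (hadj b (by omega)).symm
          · obtain ⟨b, hb, e1, e2, e3⟩ := hsub l hl
            simp only [e1, e3]
            exact (hne b (by omega)).symm
          · obtain ⟨b, hb, e1, e2, e3⟩ := hsub l hl
            simp only [e1, e2, e3] at hw ⊢
            exact (hnb b (by omega) w hw).symm
      · refine ih _ ?_ hx' rfl
        rw [← hn]
        refine Nat.add_lt_add_of_le_of_lt (Finset.card_le_card fun e he => ?_)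
          (Finset.card_lt_card ?_)
        · exact Finset.mem_filter.mpr ⟨Finset.mem_univ _, hsub (Finset.mem_filter.mp he).2⟩
        · refine ⟨Finset.sdiff_subset_sdiff le_rfl hTT.1, fun h => hTT.2 fun e he => ?_⟩
          by_contra heT
          exact (Finset.mem_sdiff.mp (h (Finset.mem_sdiff.mpr ⟨Finset.mem_univ e, heT⟩))).2 he
    by_cases hclosed : ∃ S : Finset V, S.Nonempty ∧ S.card ≤ 3 * t + 3 ∧
        (∀ v ∈ S, (activeGraph x).degree v = 2) ∧ ∀ v ∈ S, ∀ w, (activeGraph x).Adj v w → w ∈ S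
    · obtain ⟨S, hS, hcard, hdeg, hcl⟩ := hclosed
      have hcardR : (S.card : ℝ) ≤ 3 * t + 3 := by exact_mod_cast hcard
      obtain ⟨m, v, h0, hsupp, hsum, hsub⟩ := hx.exists_family_of_closed (K := 4 * (3 * t + 3) + 1)
        hG hS hdeg hcl (by linarith)
      exact hx.rounds_of_family hK1 hc h0 hsupp hsub (fun u => Or.inl (hsum u)) hind
    · have hedges := SimpleGraph.mul_card_degree_ge_two_le_card_edgeFinset (H := activeGraph x)
        (t := 3 * t + 3) (by omega) hchain hclosed
      have hD : ((Finset.univ.filter fun v => (activeGraph x).degree v = 2).card : ℝ) +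
          (Finset.univ.filter fun v => 3 ≤ (activeGraph x).degree v).card =
          (Finset.univ.filter fun v => 2 ≤ (activeGraph x).degree v).card := by
        rw [← Nat.cast_add, ← Finset.card_union_of_disjoint]
        · congr 2
          ext v
          simp only [Finset.mem_union, Finset.mem_filter, Finset.mem_univ, true_and]
          omega
        · refine Finset.disjoint_left.mpr fun v hv hv' => ?_
          have := (Finset.mem_filter.mp hv).2
          have := (Finset.mem_filter.mp hv').2
          omega
      rw [hD] at hedges
      obtain ⟨m, v, h0, hsupp, hsum, hsub⟩ := hx.exists_family_of_card_le
        (K := 4 * (3 * t + 3) + 1) (by linarith) hact (by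
          push_cast at hedges
          set d : ℝ := ((Finset.univ.filter fun v => 2 ≤ (activeGraph x).degree v).card : ℝ)
          have hpos : (0 : ℝ) < 4 * (3 * t + 3) := by linarith
          have h := mul_le_mul_of_nonneg_left hedges hpos.le
          have e : 4 * (3 * (t : ℝ) + 3) * ((1 + 1 / (4 * (3 * t + 3))) * d) =
              (4 * (3 * t + 3) + 1) * d := by field_simp
          rw [e] at h
          linarith)
      exact hx.rounds_of_family hK1 hc h0 hsupp hsub hsum hind

/-! ### From the potential to Bernstein's inequality -/

/-- Markov's inequality for the potential of `r a`; at `0`-`1` points its quadratic term vanishes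
and only the exponential of the linear form remains. -/
theorem bernstein_of_expPotential_le {ι Ω : Type*} [Fintype ι] [Fintype Ω] {A : ℝ} (hA : 0 < A)
    {p : Ω → ℝ} (hp : ∀ ω, 0 ≤ p ω) (hp1 : ∑ ω, p ω = 1) {z : Ω → ι → ℝ}
    (hz : ∀ ω i, z ω i - z ω i ^ 2 = 0) {y : ι → ℝ} (hy : ∀ i, y i ∈ Set.Icc (0 : ℝ) 1)
    (h : ∀ a : ι → ℝ, (∀ i, 4 * A * |a i| ≤ 1) →
      ∑ ω, p ω * expPotential A a (z ω) ≤ expPotential A a y)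
    {β : ℝ} (hβ : 12 * A ≤ β) (a : ι → ℝ) {M : ℝ} (hM0 : 0 ≤ M) (hM : ∀ i, |a i| ≤ M) {t : ℝ}
    (ht : 0 < t) [DecidablePred fun ω => t ≤ ∑ i, a i * z ω i - ∑ i, a i * y i] :
    ∑ ω, (if t ≤ ∑ i, a i * z ω i - ∑ i, a i * y i then p ω else 0) ≤
      Real.exp (-(t ^ 2 / β) / (2 * (∑ i, a i ^ 2 * (y i - y i ^ 2) + M * t / 3))) := by
  set S := ∑ i, a i ^ 2 * (y i - y i ^ 2) with hSdef
  have hS : 0 ≤ S := Finset.sum_nonneg fun i _ =>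
    mul_nonneg (sq_nonneg _) (by nlinarith [(hy i).1, (hy i).2])
  have hMt : 0 ≤ M * t := mul_nonneg hM0 ht.le
  -- Division by zero gives `0`, so the bound is then the trivial `exp 0 = 1`.
  by_cases hden : S + M * t / 3 = 0
  · rw [hden, mul_zero, div_zero, Real.exp_zero, ← hp1]
    exact Finset.sum_le_sum fun ω _ => by split_ifs; exacts [le_rfl, hp ω]
  have hden : 0 < S + M * t / 3 := lt_of_le_of_ne (by positivity) (Ne.symm hden)
  -- The two summands ensure `A r S ≤ t / 2` and `4 A r M ≤ 1` for `r = t / den`. The factor `12 A`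
  -- comes from `4 A M t = 12 A (M t / 3)`.
  set den := 2 * A * S + 4 * A * (M * t) with hdendef
  have hden' : 0 < den := by nlinarith
  set r := t / den with hr
  have hr0 : 0 < r := div_pos ht hden'
  have hra := h (fun i => r * a i) fun i => by
    rw [abs_mul, abs_of_pos hr0]
    have h1 : 4 * A * (r * |a i|) ≤ 4 * A * (r * M) := by gcongr; exact hM i
    have h2 : 4 * A * (r * M) = 4 * A * (M * t) / den := by rw [hr]; ring
    rw [h2] at h1
    exact h1.trans ((div_le_one hden').mpr (by nlinarith))
  have hy' : expPotential A (fun i => r * a i) y =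
      Real.exp (r * ∑ i, a i * y i + A * r ^ 2 * S) := by
    rw [expPotential, hSdef, Finset.mul_sum, Finset.mul_sum, ← Finset.sum_add_distrib]
    congr 1
    exact Finset.sum_congr rfl fun i _ => by ring
  have hz' : ∀ ω, expPotential A (fun i => r * a i) (z ω) = Real.exp (r * ∑ i, a i * z ω i) := by
    intro ω
    rw [expPotential, Finset.mul_sum]
    congr 1
    exact Finset.sum_congr rfl fun i _ => by rw [hz]; ring
  calc ∑ ω, (if t ≤ ∑ i, a i * z ω i - ∑ i, a i * y i then p ω else 0)
      ≤ ∑ ω, Real.exp (-(r * ∑ i, a i * y i) - r * t) *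
          (p ω * Real.exp (r * ∑ i, a i * z ω i)) := by
        refine Finset.sum_le_sum fun ω _ => ?_
        rw [mul_left_comm, ← Real.exp_add]
        split_ifs with hω
        · refine le_mul_of_one_le_right (hp ω) (Real.one_le_exp ?_)
          nlinarith
        · exact mul_nonneg (hp ω) (Real.exp_pos _).le
    _ = Real.exp (-(r * ∑ i, a i * y i) - r * t) *
          ∑ ω, p ω * expPotential A (fun i => r * a i) (z ω) := by
        simp_rw [hz']
        rw [← Finset.mul_sum]
    _ ≤ Real.exp (-(r * ∑ i, a i * y i) - r * t) *
          Real.exp (r * ∑ i, a i * y i + A * r ^ 2 * S) := by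
        rw [← hy']; exact mul_le_mul_of_nonneg_left hra (Real.exp_pos _).le
    _ = Real.exp (-(r * (t - A * r * S))) := by rw [← Real.exp_add]; ring_nf
    _ ≤ _ := by
        refine Real.exp_le_exp.mpr ?_
        have h1 : A * r * S ≤ t / 2 := by
          rw [hr, mul_div_assoc', div_mul_eq_mul_div, div_le_iff₀ hden']
          nlinarith [mul_nonneg hA.le hMt, mul_nonneg ht.le (mul_nonneg hA.le hMt)]
        have h2 : t ^ 2 / β / (2 * (S + M * t / 3)) ≤ t ^ 2 / (2 * den) := by
          rw [div_div]
          refine div_le_div_of_nonneg_left (by positivity) (by positivity) ?_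
          have : 12 * A * (S + M * t / 3) ≤ β * (S + M * t / 3) :=
            mul_le_mul_of_nonneg_right hβ hden.le
          nlinarith [mul_nonneg hA.le hS]
        have h3 : t ^ 2 / (2 * den) = r * (t / 2) := by rw [hr]; field_simp
        rw [neg_div, neg_le_neg_iff]
        refine h2.trans (h3.le.trans (mul_le_mul_of_nonneg_left (by linarith) hr0.le))

/-! ### The random matching -/

theorem exists_measure_of_weights {n : ℕ} {p : Fin n → ℝ} (hp : ∀ i, 0 ≤ p i)
    (hp1 : ∑ i, p i = 1) : ∃ μ : Measure (Fin n), IsProbabilityMeasure μ ∧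
      (∀ s : Set (Fin n), ∀ [DecidablePred (· ∈ s)], μ.real s = ∑ i, if i ∈ s then p i else 0) ∧
      ∀ f : Fin n → ℝ, ∫ i, f i ∂μ = ∑ i, p i * f i := by
  let P : PMF (Fin n) := PMF.ofFintype (fun i => ENNReal.ofReal (p i)) (by
    rw [← ENNReal.ofReal_sum_of_nonneg fun i _ => hp i, hp1, ENNReal.ofReal_one])
  have hint : ∀ f : Fin n → ℝ, ∫ i, f i ∂P.toMeasure = ∑ i, p i * f i := by
    intro f
    rw [PMF.integral_eq_sum]
    exact Finset.sum_congr rfl fun i _ => by simp [P, hp i]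
  refine ⟨P.toMeasure, inferInstance, fun s _ => ?_, hint⟩
  rw [← integral_indicator_one (MeasurableSet.of_discrete (s := s)), hint]
  exact Finset.sum_congr rfl fun i _ => by simp [Set.indicator_apply]

/-- The matchings of a graph, as sets of edges. -/
def MatchingEdges {V : Type*} (G : SimpleGraph V) : Type _ :=
  {m : Finset (Sym2 V) // (∀ e ∈ m, e ∈ G.edgeSet) ∧
    ∀ v, ∀ e ∈ m, ∀ e' ∈ m, v ∈ e → v ∈ e' → e = e'}

namespace MatchingEdges

variable {V : Type*} {G : SimpleGraph V}

noncomputable instance [Fintype V] [DecidableEq V] : Fintype (MatchingEdges G) := by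
  classical exact inferInstanceAs (Fintype {m : Finset (Sym2 V) // (∀ e ∈ m, e ∈ G.edgeSet) ∧
    ∀ v, ∀ e ∈ m, ∀ e' ∈ m, v ∈ e → v ∈ e' → e = e'})

/-- The subgraph formed by the edges of a matching and their endpoints. -/
def toSubgraph (m : MatchingEdges G) : G.Subgraph where
  verts := {v | ∃ e ∈ m.1, v ∈ e}
  Adj u v := s(u, v) ∈ m.1
  adj_sub h := m.2.1 _ h
  edge_vert h := ⟨_, h, Sym2.mem_mk_left _ _⟩
  symm := ⟨fun u v h => by rwa [Sym2.eq_swap]⟩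

theorem mem_edgeSet_toSubgraph (m : MatchingEdges G) (e : Sym2 V) :
    e ∈ m.toSubgraph.edgeSet ↔ e ∈ m.1 := by
  induction e with
  | _ u v => rfl

theorem isMatching_toSubgraph (m : MatchingEdges G) : m.toSubgraph.IsMatching := by
  rintro v ⟨e, he, w, rfl⟩
  refine ⟨w, he, fun w' hw' => ?_⟩
  have h := m.2.2 v _ hw' _ he (Sym2.mem_mk_left _ _) (Sym2.mem_mk_left _ _)
  exact Sym2.congr_right.mp h

open Classical in
theorem coversMatchings [Fintype V] [DecidableEq V] :
    CoversMatchings G fun (m : MatchingEdges G) e => if e ∈ m.1 then (1 : ℝ) else 0 := by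
  intro m h1 h2
  exact ⟨⟨m, h1, h2⟩, by ext e; congr⟩

end MatchingEdges

theorem sum_edgeSet_eq_sum_sym2 {V : Type*} [Fintype V] [DecidableEq V] {G : SimpleGraph V}
    [DecidableRel G.Adj] {g : Sym2 V → ℝ} (hg : ∀ e ∉ G.edgeSet, g e = 0) :
    ∑ e : G.edgeSet, g e = ∑ e, g e := by
  rw [← Finset.sum_subset (Finset.subset_univ G.edgeFinset) fun e _ he =>
    hg e (by rwa [SimpleGraph.mem_edgeFinset] at he)]
  exact (Finset.sum_subtype G.edgeFinset (fun e => SimpleGraph.mem_edgeFinset) g).symm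

open Classical in
/-- Rounding of a fractional perfect matching, as a distribution on the matchings. -/
theorem exists_matching_distribution {V : Type*} [Fintype V] [DecidableEq V] {G : SimpleGraph V}
    [DecidableRel G.Adj] (hG : G.IsBipartite) {x : G.edgeSet → ℝ}
    (hx : IsFractionalPerfectMatching G x) {δ : ℝ} (hδ : 0 < δ) (hδ1 : δ ≤ 1) :
    ∃ (A : ℝ) (p : MatchingEdges G → ℝ), 0 < A ∧ 12 * A ≤ 5000 / δ ∧ (∀ m, 0 ≤ p m) ∧
      ∑ m, p m = 1 ∧
      ∀ f ∈ testFunctions (Sym2 V) A, ∑ m, p m * f (fun e => if e ∈ m.1 then 1 else 0) ≤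
        f fun e => if h : e ∈ G.edgeSet then (1 - δ) * x ⟨e, h⟩ else 0 := by
  let X : Sym2 V → ℝ := fun e => if h : e ∈ G.edgeSet then x ⟨e, h⟩ else 0
  have hX0 : ∀ e ∉ G.edgeSet, X e = 0 := fun e he => dif_neg he
  have hX1 : ∀ e : G.edgeSet, X e = x e := fun e => dif_pos e.2
  -- The ceiling gives `1 ≤ δ t`, hence `κ ≤ 1`; the extra one gives `2 ≤ t` even for `δ = 1`.
  let t : ℕ := ⌈1 / δ⌉₊ + 1
  have hδ' : 1 ≤ 1 / δ := by rwa [one_le_div hδ]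
  have htlow : 1 / δ + 1 ≤ t := by
    have := Nat.le_ceil (1 / δ)
    push_cast [t]; linarith
  have htup : (t : ℝ) ≤ 1 / δ + 2 := by
    have := (Nat.ceil_lt_add_one (a := 1 / δ) (by linarith)).le
    push_cast [t]; linarith
  have htR : (2 : ℝ) ≤ t := by linarith
  have ht : 2 ≤ t := by exact_mod_cast htR
  -- No edge is exposed at the start, so all carry the factor `κ (t-1)/t = 1 - δ`.
  let κ : ℝ := (1 - δ) * (t / (t - 1))
  have ht1 : (0 : ℝ) < t - 1 := by linarith
  have hκ : κ ∈ Set.Icc (0 : ℝ) 1 := by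
    refine ⟨mul_nonneg (by linarith) (by positivity), ?_⟩
    simp only [κ]
    rw [mul_div_assoc', div_le_one ht1]
    have : 1 ≤ δ * t := by
      have := mul_le_mul_of_nonneg_left htlow hδ.le
      rw [mul_add, mul_one_div_cancel hδ.ne'] at this
      linarith
    linarith
  have hstate : IsRoundingState G t X ∅ :=
    { mem_Icc := fun e => by
        by_cases h : e ∈ G.edgeSet
        · exact hX1 ⟨e, h⟩ ▸ hx.mem_Icc ⟨e, h⟩
        · rw [hX0 e h]; simp
      support := fun e he => by_contra fun h => he (hX0 e h)
      sum_le := fun v => by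
        rw [vertexSum_apply, Finset.sum_filter, ← sum_edgeSet_eq_sum_sym2 (G := G) fun e he => by
          simp [hX0 e he]]
        simp_rw [hX1]
        exact (hx.sum_eq_one v).le
      nearLeaf := fun u v h => absurd h (Finset.notMem_empty _) }
  obtain ⟨p, hp, hp1, hp1', hf⟩ := hstate.rounds hG MatchingEdges.coversMatchings ht hκ
  refine ⟨7 * (4 * (3 * t + 3) + 1), p, by positivity, ?_, hp, le_antisymm hp1 (by linarith),
    fun f hf' => (hf f hf').trans_eq ?_⟩
  · have e : 5000 / δ = 5000 * (1 / δ) := by ring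
    -- `12 · 7 · (12 t + 13)` with `t ≤ 1/δ + 2` and `1 ≤ 1/δ`.
    rw [e]; linarith
  · congr 1
    ext e
    rw [if_neg (Finset.notMem_empty e)]
    have hκt : κ * ((t - 1) / t) = 1 - δ := by
      have : (t : ℝ) ≠ 0 := by linarith
      simp only [κ]; field_simp
    rw [hκt]
    by_cases h : e ∈ G.edgeSet
    · simp [X, h]
    · simp [X, h]

theorem exists_concentrated_matching {V : Type*} [Fintype V] [DecidableEq V] {G : SimpleGraph V}
    [DecidableRel G.Adj] (hG : G.IsBipartite) {x : G.edgeSet → ℝ}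
    (hx : IsFractionalPerfectMatching G x) {δ : ℝ} (hδ : 0 < δ) (hδ1 : δ ≤ 1) :
    ∃ (Ω : Type) (_ : MeasurableSpace Ω) (μ : Measure Ω) (M : Ω → G.Subgraph),
      IsProbabilityMeasure μ ∧
      (∀ e : G.edgeSet, MeasurableSet {ω | (e : Sym2 V) ∈ (M ω).edgeSet}) ∧
      (∀ ω, (M ω).IsMatching) ∧
      (∀ v : V, 1 - δ ≤ μ.real {ω | v ∈ (M ω).verts}) ∧
      (∀ e : G.edgeSet, μ.real {ω | (e : Sym2 V) ∈ (M ω).edgeSet} = (1 - δ) * x e) ∧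
      IsBetaConcentrated μ (fun ω => edgeIndicator (M ω)) (5000 / δ) := by
  classical
  obtain ⟨A, p, hA, hβ, hp, hp1, hf⟩ := exists_matching_distribution hG hx hδ hδ1
  set y : Sym2 V → ℝ := fun e => if h : e ∈ G.edgeSet then (1 - δ) * x ⟨e, h⟩ else 0 with hydef
  have hy1 : ∀ e : G.edgeSet, y e = (1 - δ) * x e := fun e => dif_pos e.2
  have hy0 : ∀ e ∉ G.edgeSet, y e = 0 := fun e he => dif_neg he
  have hyI : ∀ e, y e ∈ Set.Icc (0 : ℝ) 1 := by
    intro e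
    by_cases h : e ∈ G.edgeSet
    · rw [hy1 ⟨e, h⟩]
      have := hx.mem_Icc ⟨e, h⟩
      exact ⟨mul_nonneg (by linarith) this.1, mul_le_one₀ (by linarith) this.1 this.2⟩
    · rw [hy0 e h]; simp
  let Z : MatchingEdges G → Sym2 V → ℝ := fun m e => if e ∈ m.1 then 1 else 0
  have hmean : ∀ e, ∑ m, p m * Z m e = y e := by
    intro e
    refine le_antisymm (hf (fun y => y e) (Or.inr ⟨e, Or.inl rfl⟩)) ?_
    have := hf (fun y => 1 - y e) (Or.inr ⟨e, Or.inr rfl⟩)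
    simp only [mul_sub, mul_one, Finset.sum_sub_distrib, hp1] at this
    linarith
  -- The matchings live in the universe of `V`, while `Ω` has to be in `Type`.
  let eqv := Fintype.equivFin (MatchingEdges G)
  obtain ⟨μ, hμ, hreal, hint⟩ := exists_measure_of_weights (p := fun i => p (eqv.symm i))
    (fun i => hp _) (by rw [← hp1]; exact eqv.symm.sum_comp p)
  have hreal' : ∀ Q : MatchingEdges G → Prop,
      μ.real {i | Q (eqv.symm i)} = ∑ m, if Q m then p m else 0 := by
    intro Q
    rw [hreal]
    exact eqv.symm.sum_comp fun m => if Q m then p m else 0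
  have hedge : ∀ e : Sym2 V, ∑ m : MatchingEdges G, (if e ∈ m.toSubgraph.edgeSet then p m else 0) =
      y e := by
    intro e
    rw [← hmean]
    exact Finset.sum_congr rfl fun m _ => by simp [Z, MatchingEdges.mem_edgeSet_toSubgraph]
  refine ⟨_, inferInstance, μ, fun i => (eqv.symm i).toSubgraph, hμ, fun e =>
    MeasurableSet.of_discrete, fun i => MatchingEdges.isMatching_toSubgraph _, fun v => ?_,
    fun e => ?_, fun a t ht => ?_⟩
  · rw [hreal' fun m => v ∈ m.toSubgraph.verts]
    have hsum : ∑ e : G.edgeSet, (if v ∈ (e : Sym2 V) then y e else 0) = 1 - δ := by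
      have : ∀ e : G.edgeSet, (if v ∈ (e : Sym2 V) then y e else 0) =
          (1 - δ) * if v ∈ (e : Sym2 V) then x e else 0 := by
        intro e; split_ifs <;> simp [hy1]
      simp_rw [this]
      rw [← Finset.mul_sum, hx.sum_eq_one, mul_one]
    rw [← hsum, sum_edgeSet_eq_sum_sym2 (g := fun e => if v ∈ e then y e else 0) fun e he => by
      simp [hy0 e he]]
    simp_rw [← hmean, ← Finset.sum_filter]
    rw [Finset.sum_comm, Finset.sum_filter]
    refine Finset.sum_le_sum fun m _ => ?_
    rw [← Finset.mul_sum]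
    simp only [Z, ← Finset.sum_filter, Finset.sum_const, nsmul_eq_mul, mul_one]
    -- A matching has at most one edge at `v`, so the edge probabilities at `v`, which sum to `1 -
    -- δ`, bound the probability of covering `v` from below.
    have hcard : ((Finset.univ.filter fun e => v ∈ e).filter (· ∈ m.1)).card ≤ 1 := by
      refine Finset.card_le_one.mpr fun e he e' he' => ?_
      simp only [Finset.mem_filter, Finset.mem_univ, true_and] at he he'
      exact m.2.2 v e he.2 e' he'.2 he.1 he'.1
    split_ifs with hv
    · exact mul_le_of_le_one_right (hp m) (by exact_mod_cast hcard)
    · rw [Finset.filter_eq_empty_iff.mpr fun e he hem =>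
        hv ⟨e, hem, (Finset.mem_filter.mp he).2⟩]
      simp
  · rw [hreal' fun m => (e : Sym2 V) ∈ m.toSubgraph.edgeSet, hedge, hy1]
  · have hind : ∀ (i) (e : G.edgeSet), edgeIndicator (eqv.symm i).toSubgraph e =
        Z (eqv.symm i) e := by
      intro i e
      simp [edgeIndicator, Z, Set.indicator_apply, MatchingEdges.mem_edgeSet_toSubgraph]
    have hE : ∀ e : G.edgeSet, ∫ i, edgeIndicator (eqv.symm i).toSubgraph e ∂μ = y e := by
      intro e
      rw [hint, ← hmean]
      simp_rw [hind]
      exact eqv.symm.sum_comp fun m => p m * Z m e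
    -- Extension by zero to all pairs, where the potentials are defined, changes none of the sums.
    let b : Sym2 V → ℝ := fun e => if h : e ∈ G.edgeSet then a ⟨e, h⟩ else 0
    have hb1 : ∀ e : G.edgeSet, b e = a e := fun e => dif_pos e.2
    have hb0 : ∀ e ∉ G.edgeSet, b e = 0 := fun e he => dif_neg he
    have hlin : ∀ w : Sym2 V → ℝ, ∑ e : G.edgeSet, a e * w e = ∑ e, b e * w e := by
      intro w
      rw [← sum_edgeSet_eq_sum_sym2 (G := G) fun e he => by simp [hb0 e he]]
      simp_rw [hb1]
    have hquad : ∑ e : G.edgeSet, a e ^ 2 * (y e - y e ^ 2) =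
        ∑ e, b e ^ 2 * (y e - y e ^ 2) := by
      rw [← sum_edgeSet_eq_sum_sym2 (G := G) fun e he => by simp [hb0 e he]]
      simp_rw [hb1]
    have hEa : ∫ i, ∑ e : G.edgeSet, a e * edgeIndicator (eqv.symm i).toSubgraph e ∂μ =
        ∑ e, b e * y e := by
      rw [hint]
      simp_rw [hind, hlin, Finset.mul_sum]
      rw [Finset.sum_comm]
      refine Finset.sum_congr rfl fun e _ => ?_
      rw [← hmean, Finset.mul_sum, ← eqv.symm.sum_comp]
      exact Finset.sum_congr rfl fun i _ => by ring
    simp_rw [hE, hquad, hEa, hind, hlin]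
    rw [hreal' fun m => t ≤ ∑ e, b e * Z m e - ∑ e, b e * y e]
    refine bernstein_of_expPotential_le (z := Z) (y := y) hA hp hp1 (fun m e => ?_) hyI
      (fun a ha => hf _ (Or.inl ⟨a, ha, rfl⟩)) hβ b (Real.iSup_nonneg fun e => abs_nonneg _)
      (fun e => ?_) ht
    · simp only [Z]; split_ifs <;> norm_num
    · by_cases h : e ∈ G.edgeSet
      · rw [hb1 ⟨e, h⟩]
        exact le_ciSup (f := fun e => |a e|) (Set.finite_range _).bddAbove ⟨e, h⟩
      · rw [hb0 e h, abs_zero]; exact Real.iSup_nonneg fun e => abs_nonneg _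

theorem mainTheorem7 :
    -- the rounding theorem, with `O(1/δ) = C/δ` for an absolute constant `C`
    (∃ C : ℝ, 1 ≤ C ∧
      ∀ (V : Type*) [Fintype V] [DecidableEq V] (G : SimpleGraph V) [DecidableRel G.Adj],
        G.IsBipartite →
        ∀ x : G.edgeSet → ℝ, IsFractionalPerfectMatching G x →
        ∀ δ : ℝ, 0 < δ → δ ≤ 1 →
          ∃ (Ω : Type) (_ : MeasurableSpace Ω) (μ : Measure Ω) (M : Ω → G.Subgraph),
            IsProbabilityMeasure μ ∧
            (∀ e : G.edgeSet, MeasurableSet {ω | (e : Sym2 V) ∈ (M ω).edgeSet}) ∧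
            (∀ ω, (M ω).IsMatching) ∧
            (∀ v : V, 1 - δ ≤ μ.real {ω | v ∈ (M ω).verts}) ∧
            (∀ e : G.edgeSet, μ.real {ω | (e : Sym2 V) ∈ (M ω).edgeSet} = (1 - δ) * x e) ∧
            IsBetaConcentrated μ (fun ω => edgeIndicator (M ω)) (C / δ)) ∧
    -- the graph lemma
    (∀ (V : Type*) [Fintype V] [DecidableEq V] (G : SimpleGraph V) [DecidableRel G.Adj] (t : ℕ),
      2 ≤ t → G.Connected → ¬ IsCycleGraph G →
      (¬ ∃ (u v : V) (p : G.Walk u v), p.IsPath ∧ p.support.length = t ∧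
        ∀ w ∈ p.support, G.degree w = 2) →
      (1 + 1 / (4 * (t : ℝ))) *
          (((Finset.univ.filter fun v : V => G.degree v = 2).card : ℝ) +
            ((Finset.univ.filter fun v : V => 3 ≤ G.degree v).card : ℝ)) ≤
        (G.edgeFinset.card : ℝ)) := by
  refine ⟨⟨5000, by norm_num, fun V _ _ G _ hG x hx δ hδ hδ1 =>
    exists_concentrated_matching hG hx hδ hδ1⟩, fun V _ _ G _ t ht hconn hcycle hpath =>
    hconn.mul_card_degree_ge_two_le_card_edgeFinset ht hcycle hpath⟩
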